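/- Let $A\in\mathbb R^{n\times n}$ and $B_{i\sigma}\in\mathbb R^{n\times 1}$ ($1\le i\le q$, $1\le\sigma\le p$, $q\ge 2$) satisfy $\sum_{i=1}^q B_{i\sigma}=0$ for every $\sigma$, and consider the array $\dot x_i=Ax_i+\sum_{\sigma=1}^p B_{i\sigma}u_\sigma$, $i=1,\dots,q$. Fix distinct $k,\ell\in\{1,\dots,q\}$. The array is positively $(k,\ell)$-controllable if for all initial conditions $(x_1(0),\dots,x_q(0))$ there are $\tau>0$ and inputs $u_\sigma:[0,\tau]\to\mathbb R_{\ge 0}$ such that $x_k(\tau)=x_\ell(\tau)$ and $x_i(\tau)=e^{A\tau}x_i(0)$ for all $i\ne k,\ell$. Let $\mathbf A=I_q\otimes A$, let $\mathbf B\in\mathbb R^{(qn)\times p}$ be the matrix with blocks $B_{i\sigma}$, and let $$\mathcal R=\Big\{\int_0^\tau e^{\mathbf A(\tau-t)}\mathbf B\,u(t)\,dt:\ \tau\ge 0,\ u:[0,\tau]\to\mathbb R_{\ge 0}^p\Big\}.$$ (Inputs are integrable.) Here $e_i$ is the $i$th unit vector of $\mathbb R^q$. A matrix $G$ with $qd$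 rows is called $(k,\ell)$-connected if $\operatorname{range}G\supset\operatorname{range}[(e_k-e_\ell)\otimes I_d]$, and strongly $(k,\ell)$-connected if it is real and $\operatorname{cone}G:=\{G\alpha:\alpha\ge 0\}\supset\operatorname{range}[(e_k-e_\ell)\otimes I_d]$. Let $\mu_1,\dots,\mu_m$ be the distinct (complex) eigenvalues of $A^*$, with algebraic multiplicities $n_1,\dots,n_m$, enumerated so that $\operatorname{Re}\mu_1\ge\dots\ge\operatorname{Re}\mu_m$ and so that $\operatorname{Re}\mu_\kappa=\mu_\nu$ with $\kappa\neq\nu$ implies $\kappa>\nu$. Let $U_\kappa\in\mathbb C^{n\times n_\kappa}$ have full column rank with $\operatorname{range}U_\kappa=\operatorname{null}[A^*-\mu_\kappa I_n]^{n_\kappa}$, $U_\kappa$ real if $\mu_\kappa$ is real; let $A_\kappa$ be the matrix with $A^*U_\kappa=U_\kappa A_\kappa^*$, and put $\Lambda_\kappa=[A_\kappa^*-\mu_\kappa I_{n_\kappa}]^*$, $B^{[\kappa]}_{i\sigma}=U_\kappa^*B_{i\sigma}$ and $Q^{[\kappa]}_{i\sigma}=[B^{[\kappa]}_{i\sigma}\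 \ \Lambda_\kappa B^{[\kappa]}_{i\sigma}\ \cdots\ \Lambda_\kappa^{n_\kappa-1}B^{[\kappa]}_{i\sigma}]$. Let $B^{[\kappa]}_{:\sigma}$ be the column obtained by stacking $B^{[\kappa]}_{1\sigma},\dots,B^{[\kappa]}_{q\sigma}$ and, for $\mathcal I\subset\{1,\dots,p\}$, let $\operatorname{inc}(Q^{[\kappa]}_{:\sigma})_{\sigma\in\mathcal I}$ be the block matrix with block rows $i=1,\dots,q$, block columns $\sigma\in\mathcal I$ and blocks $Q^{[\kappa]}_{i\sigma}$. Define index sets by $\mathcal I_1=\{1,\dots,p\}$ and $\mathcal I_{\kappa+1}=\mathcal I_\kappa\setminus\mathcal I_\kappa^-$, where $\mathcal I_\kappa^-=\emptyset$ if $\mu_\kappa\notin\mathbb R$, and, if $\mu_\kappa\in\mathbb R$, $$\mathcal I_\kappa^-=\{\sigma\in\mathcal I_\kappa:\ [I_q\otimes\Lambda_\kappa^r]B^{[\kappa]}_{:\sigma}\notin\mathcal Q_\kappa\text{ for some }r\in\{0,\dots,n_\kappa-1\}\},$$ with $\mathcal Q_\kappa$ the largest subspace contained in $\operatorname{cone}[\operatorname{inc}(Q^{[\kappa]}_{:\sigma})_{\sigma\in\mathcal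 I_\kappa}]$. Assume: (1) if $\mu_\kappa\notin\mathbb R$ and $\operatorname{Re}\mu_\kappa=\mu_\nu$ for some $\nu$, then $\Lambda_\kappa=0$; (2) if $\operatorname{cl}\mathcal R\supset\operatorname{range}[(e_k-e_\ell)\otimes I_n]$, then $\mathcal R\supset\operatorname{range}[(e_k-e_\ell)\otimes I_n]$. Then the array is positively $(k,\ell)$-controllable if and only if both of the following hold: (a) $\operatorname{inc}(Q^{[\kappa]}_{:\sigma})_{\sigma\in\mathcal I_\kappa}$ is strongly $(k,\ell)$-connected for all $\kappa$ with $\mu_\kappa\in\mathbb R$; (b) $\operatorname{inc}(Q^{[\kappa]}_{:\sigma})_{\sigma\in\mathcal I_\kappa}$ is $(k,\ell)$-connected for all $\kappa$ with $\mu_\kappa\notin\mathbb R$. -/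

import Mathlib

open Matrix MeasureTheory
open scoped Kronecker

noncomputable section

namespace RelArray

/-! ### Arrays of systems `ẋ_i = A x_i + ∑_σ B_{iσ} u_σ` and positive controllability -/

/-- The actuation is relative: `∑_i B_{iσ} = 0` for every `σ`. -/
def IsRelative {q p n : ℕ} (B : Fin q → Fin p → Fin n → ℝ) : Prop :=
  ∀ σ, ∑ i, B i σ = 0

/-- Nonnegative input signals on the time interval `[0, τ]` (integrable, so that the
differential equation makes sense). -/
def IsPositiveInput {p : ℕ} (τ : ℝ) (u : ℝ → Fin p → ℝ) : Prop :=
  (∀ σ, IntervalIntegrable (fun t => u t σ) volume 0 τ) ∧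
    ∀ t ∈ Set.Icc (0 : ℝ) τ, ∀ σ, 0 ≤ u t σ

/-- `x` is a (Carathéodory) solution on `[0, τ]` of the array
`ẋ_i = A x_i + ∑_σ B_{iσ} u_σ`, `i = 1, …, q`: it is continuous and satisfies the
equation in integrated form. -/
def IsTrajectory {q p n : ℕ} (A : Matrix (Fin n) (Fin n) ℝ) (B : Fin q → Fin p → Fin n → ℝ)
    (τ : ℝ) (u : ℝ → Fin p → ℝ) (x : ℝ → Fin q → Fin n → ℝ) : Prop :=
  ContinuousOn x (Set.Icc 0 τ) ∧
    ∀ t ∈ Set.Icc (0 : ℝ) τ, ∀ i,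
      x t i = x 0 i + ∫ s in (0 : ℝ)..t, (A *ᵥ x s i + ∑ σ, u s σ • B i σ)

/-- Positive `(k, ℓ)`-controllability of the array `[A, (B_{iσ})]`. -/
def PositivelyPairControllable {q p n : ℕ} (A : Matrix (Fin n) (Fin n) ℝ)
    (B : Fin q → Fin p → Fin n → ℝ) (k l : Fin q) : Prop :=
  ∀ x₀ : Fin q → Fin n → ℝ, ∃ τ : ℝ, 0 < τ ∧ ∃ u : ℝ → Fin p → ℝ, IsPositiveInput τ u ∧
    ∃ x : ℝ → Fin q → Fin n → ℝ, IsTrajectory A B τ u x ∧ x 0 = x₀ ∧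
      x τ k = x τ l ∧
      ∀ i, i ≠ k → i ≠ l → x τ i = NormedSpace.exp (τ • A) *ᵥ x₀ i

/-- The system matrix `I_q ⊗ A` of the array seen as one big system. -/
def bigA (q : ℕ) {n : ℕ} (A : Matrix (Fin n) (Fin n) ℝ) :
    Matrix (Fin q × Fin n) (Fin q × Fin n) ℝ :=
  (1 : Matrix (Fin q) (Fin q) ℝ) ⊗ₖ A

/-- The input matrix `inc (B_{iσ})` of the big system. -/
def bigB {q p n : ℕ} (B : Fin q → Fin p → Fin n → ℝ) : Matrix (Fin q × Fin n) (Fin p) ℝ :=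
  Matrix.of fun ia σ => B ia.1 σ ia.2

/-- The set of points positively reachable from the origin in finite time. -/
def reachable {q p n : ℕ} (A : Matrix (Fin n) (Fin n) ℝ) (B : Fin q → Fin p → Fin n → ℝ) :
    Set (Fin q × Fin n → ℝ) :=
  {ξ | ∃ τ : ℝ, 0 ≤ τ ∧ ∃ u : ℝ → Fin p → ℝ, IsPositiveInput τ u ∧
    ξ = ∫ t in (0 : ℝ)..τ, NormedSpace.exp ((τ - t) • bigA q A) *ᵥ (bigB B *ᵥ u t)}

/-! ### Connectivity of matrices -/

/-- The matrix `(e_k - e_ℓ) ⊗ I_d`. -/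
def pairMatrix (𝕜 : Type) [RCLike 𝕜] {q : ℕ} (k l : Fin q) (d : ℕ) :
    Matrix (Fin q × Fin d) (Fin d) 𝕜 :=
  Matrix.of fun ia b =>
    (Pi.single k (1 : 𝕜) - Pi.single l (1 : 𝕜) : Fin q → 𝕜) ia.1 *
      (1 : Matrix (Fin d) (Fin d) 𝕜) ia.2 b

/-- `cone G = {G α : α ≥ 0}` for a real matrix `G`. -/
def cone {ρ ι : Type} [Fintype ι] (G : Matrix ρ ι ℝ) : Set (ρ → ℝ) :=
  {ζ | ∃ α : ι → ℝ, (∀ j, 0 ≤ α j) ∧ ζ = G *ᵥ α}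

/-- `(k, ℓ)`-connectivity: `range G ⊇ range [(e_k - e_ℓ) ⊗ I_d]`. -/
def PairConnected {q d : ℕ} {ι : Type} [Fintype ι] (G : Matrix (Fin q × Fin d) ι ℂ)
    (k l : Fin q) : Prop :=
  Set.range (pairMatrix ℂ k l d).mulVec ⊆ Set.range G.mulVec

/-- Strong `(k, ℓ)`-connectivity: `G` is real and `cone G ⊇ range [(e_k - e_ℓ) ⊗ I_d]`. -/
def StronglyPairConnected {q d : ℕ} {ι : Type} [Fintype ι] (G : Matrix (Fin q × Fin d) ι ℂ)
    (k l : Fin q) : Prop :=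
  (∀ a j, (G a j).im = 0) ∧
    Set.range (pairMatrix ℝ k l d).mulVec ⊆ cone (G.map Complex.re)

/-- The incidence matrix of a collection of `d × ρ` blocks `C i σ`, with columns restricted to
the index set `I`. -/
def inc {q p d : ℕ} {ρ : Type} (C : Fin q → Fin p → Matrix (Fin d) ρ ℂ) (I : Finset (Fin p)) :
    Matrix (Fin q × Fin d) (I × ρ) ℂ :=
  Matrix.of fun ia σr => C ia.1 σr.1 ia.2 σr.2

/-! ### Spectral data of `A*` -/

/-- The matrix `A*`, regarded as a complex matrix. -/
def adj {n : ℕ} (A : Matrix (Fin n) (Fin n) ℝ) : Matrix (Fin n) (Fin n) ℂ :=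
  (A.map Complex.ofReal)ᴴ

/-- The algebraic multiplicity of `z` as an eigenvalue of `A*`. -/
def algMult {n : ℕ} (A : Matrix (Fin n) (Fin n) ℝ) (z : ℂ) : ℕ :=
  (adj A).charpoly.rootMultiplicity z

/-- A choice of the auxiliary objects attached to the spectrum of `A*`: an admissible enumeration
`μ_1, …, μ_m` of the distinct eigenvalues, bases `U_κ` of the generalized eigenspaces, and the
matrices `A_κ` of `A*` in those bases. -/
structure SpectralData {n : ℕ} (A : Matrix (Fin n) (Fin n) ℝ) where
  /-- the number of distinct eigenvalues -/
  m : ℕ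
  /-- the distinct eigenvalues of `A*` -/
  μ : Fin m → ℂ
  μ_injective : Function.Injective μ
  μ_range : ∀ z : ℂ, (∃ κ, μ κ = z) ↔ Module.End.HasEigenvalue (Matrix.toLin' (adj A)) z
  /-- real parts are nonincreasing -/
  μ_antitone : ∀ κ ν, κ ≤ ν → (μ ν).re ≤ (μ κ).re
  /-- a real eigenvalue precedes the other eigenvalues with the same real part -/
  μ_real_first : ∀ κ ν, κ ≠ ν → ((μ κ).re : ℂ) = μ ν → ν < κ
  /-- the columns of `U κ` form a basis of `null (A* - μ_κ I)^{n_κ}` -/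
  U : ∀ κ, Matrix (Fin n) (Fin (algMult A (μ κ))) ℂ
  U_linearIndependent : ∀ κ, LinearIndependent ℂ (U κ).col
  U_range : ∀ κ, LinearMap.range (U κ).mulVecLin =
    LinearMap.ker ((adj A - μ κ • (1 : Matrix (Fin n) (Fin n) ℂ)) ^ algMult A (μ κ)).mulVecLin
  /-- `U κ` is real for a real eigenvalue -/
  U_real : ∀ κ, (μ κ).im = 0 → ∀ a b, (U κ a b).im = 0
  /-- the matrix `A_κ`, determined by `A* U_κ = U_κ A_κ*` -/
  Ared : ∀ κ, Matrix (Fin (algMult A (μ κ))) (Fin (algMult A (μ κ))) ℂ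
  Ared_spec : ∀ κ, adj A * U κ = U κ * (Ared κ)ᴴ

namespace SpectralData

variable {q p n : ℕ} {A : Matrix (Fin n) (Fin n) ℝ}

/-- The algebraic multiplicity `n_κ`. -/
abbrev mult (D : SpectralData A) (κ : Fin D.m) : ℕ := algMult A (D.μ κ)

/-- `Λ_κ = [A_κ* - μ_κ I]*`. -/
def Lam (D : SpectralData A) (κ : Fin D.m) : Matrix (Fin (D.mult κ)) (Fin (D.mult κ)) ℂ :=
  ((D.Ared κ)ᴴ - D.μ κ • (1 : Matrix (Fin (D.mult κ)) (Fin (D.mult κ)) ℂ))ᴴ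

/-- `B_{iσ}^{[κ]} = U_κ* B_{iσ}`. -/
def Bk (D : SpectralData A) (B : Fin q → Fin p → Fin n → ℝ) (κ : Fin D.m) (i : Fin q)
    (σ : Fin p) : Fin (D.mult κ) → ℂ :=
  (D.U κ)ᴴ *ᵥ fun a => (B i σ a : ℂ)

/-- `Q_{iσ}^{[κ]} = [B_{iσ}^{[κ]}, Λ_κ B_{iσ}^{[κ]}, …, Λ_κ^{n_κ - 1} B_{iσ}^{[κ]}]`. -/
def Q (D : SpectralData A) (B : Fin q → Fin p → Fin n → ℝ) (κ : Fin D.m) (i : Fin q)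
    (σ : Fin p) : Matrix (Fin (D.mult κ)) (Fin (D.mult κ)) ℂ :=
  Matrix.of fun a r => (D.Lam κ ^ (r : ℕ) *ᵥ D.Bk B κ i σ) a

/-- The largest subspace contained in `cone [inc (Q_{:σ}^{[κ]})_{σ ∈ I}]` (the matrix is real when
`μ_κ` is real, the only case in which this is used). The cone is closed under addition, so the
supremum of the subspaces that it contains is again contained in it. -/
def lineality (D : SpectralData A) (B : Fin q → Fin p → Fin n → ℝ) (κ : Fin D.m)
    (I : Finset (Fin p)) : Submodule ℝ (Fin q × Fin (D.mult κ) → ℝ) :=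
  sSup {S | (S : Set (Fin q × Fin (D.mult κ) → ℝ)) ⊆ cone ((inc (D.Q B κ) I).map Complex.re)}

/-- The vector `[I_q ⊗ Λ_κ^r] B_{:σ}^{[κ]}`, as a real vector (it is real when `μ_κ` is). -/
def LamB (D : SpectralData A) (B : Fin q → Fin p → Fin n → ℝ) (κ : Fin D.m) (r : ℕ)
    (σ : Fin p) : Fin q × Fin (D.mult κ) → ℝ :=
  fun ia => ((D.Lam κ ^ r *ᵥ D.Bk B κ ia.1 σ) ia.2).re

open Classical in
/-- The set `I_κ^-` of indices that are removed from `I_κ = I`. -/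
def removed (D : SpectralData A) (B : Fin q → Fin p → Fin n → ℝ) (κ : Fin D.m)
    (I : Finset (Fin p)) : Finset (Fin p) :=
  if (D.μ κ).im = 0 then
    I.filter fun σ => ∃ r : Fin (D.mult κ), D.LamB B κ r σ ∉ D.lineality B κ I
  else ∅

/-- The recursion `I_{κ+1} = I_κ \ I_κ^-` starting from the full index set. The count starts
at `0` here, and the sequence is constant once the eigenvalues are exhausted. -/
def indexSeq (D : SpectralData A) (B : Fin q → Fin p → Fin n → ℝ) : ℕ → Finset (Fin p)
  | 0 => Finset.univ
  | j + 1 =>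
    if h : j < D.m then indexSeq D B j \ D.removed B ⟨j, h⟩ (indexSeq D B j)
    else indexSeq D B j

/-- The index set `I_κ`. -/
def index (D : SpectralData A) (B : Fin q → Fin p → Fin n → ℝ) (κ : Fin D.m) :
    Finset (Fin p) :=
  D.indexSeq B κ

/-- The matrix `inc (Q_{:σ}^{[κ]})_{σ ∈ I_κ}`. -/
def incQ (D : SpectralData A) (B : Fin q → Fin p → Fin n → ℝ) (κ : Fin D.m) :
    Matrix (Fin q × Fin (D.mult κ)) (D.index B κ × Fin (D.mult κ)) ℂ :=
  inc (D.Q B κ) (D.index B κ)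

/-- A non-real eigenvalue whose real part is an eigenvalue is semisimple. -/
def SemisimpleAssumption (D : SpectralData A) : Prop :=
  ∀ κ, (D.μ κ).im ≠ 0 → (∃ ν, ((D.μ κ).re : ℂ) = D.μ ν) → D.Lam κ = 0

end SpectralData

/-- If the closure of the positively reachable cone contains `range [(e_k - e_ℓ) ⊗ I_n]`, then so
does the cone itself. -/
def ClosureAssumption {q p n : ℕ} (A : Matrix (Fin n) (Fin n) ℝ)
    (B : Fin q → Fin p → Fin n → ℝ) (k l : Fin q) : Prop :=
  Set.range (pairMatrix ℝ k l n).mulVec ⊆ closure (reachable A B) →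
    Set.range (pairMatrix ℝ k l n).mulVec ⊆ reachable A B

end RelArray

end

noncomputable section

namespace RelArray

/-! ### Finitely generated cones and separation -/

/-! Relative actuation makes the forced responses of the subsystems sum to zero, so bringing `x_k`
and `x_l` together without disturbing the others means reaching a vector `(e_k - e_l) ⊗ w` fixed by
the initial gap. Reachable cones grow with time and a subspace is a cone on finitely many vectors,
so one horizon serves all `w` and the factor `e^{Aτ}` can be absorbed: controllability says that the
reachable cone contains the pair subspace (`positivelyPairControllable_iff`). Up to closure,
separation dualizes this: every adjoint state `η` whose outputs `∑_i ⟨B_{iσ}, e^{tA*} η_i⟩` are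
nonnegative for all `t ≥ 0` must satisfy `η_k = η_l` (`range_subset_closure_reachable_iff`). The
closure assumption is what lets this dual statement return to reachability.

Split `η` along the generalized eigenspaces of `A*`. Each output becomes an exponential polynomial
whose coefficients at `μ_κ` are pairings with the columns of `Q^{[κ]}`. For a nonnegative one, a
real dominant exponent controls all exponents with the same real part (`norm_coeff_le_of_nonneg`):
the Laplace transform at `s + iω` is bounded in modulus by that at `s`.

Sufficiency peels off eigenvalues in their order (`coeff_elimination_step`). At a real one, a time
shift puts the component of `η` in the dual of the cone of columns, so strong connectivity gives
agreement on the pair; outputs whose columns all lie in the lineality space receive nothing from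
this eigenvalue, and exactly these stay in the index set. At a non-real one the competing real
coefficient is already zero, so all coefficients vanish and plain connectivity suffices.

Necessity is a perturbation argument (`re_U_mulVec_eq_of_outputC_nonneg`). A state in the eigenspace
of `μ_κ` only needs nonnegative outputs in `I_κ`: every discarded output can be made to grow at the
rate of the earlier real eigenvalue that discarded it, by adding relative-interior vectors of the
dual cones there. Semisimplicity ensures that this growth beats a small multiple of the state when
the real parts coincide. Farkas' lemma, or orthogonality over `ℂ`, then gives connectivity. -/

lemma exists_dotProduct_neg_of_notMem_closure {ι : Type*} [Fintype ι]
    (C : PointedCone ℝ (ι → ℝ)) {v : ι → ℝ} (hv : v ∉ closure (C : Set (ι → ℝ))) :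
    ∃ η : ι → ℝ, (∀ x ∈ C, 0 ≤ x ⬝ᵥ η) ∧ v ⬝ᵥ η < 0 := by
  classical
  let K : ProperCone ℝ (ι → ℝ) := ⟨C.closure, isClosed_closure⟩
  obtain ⟨f, hf, hfv⟩ := K.hyperplane_separation_point (x₀ := v) hv
  have key : ∀ x : ι → ℝ, f x = x ⬝ᵥ fun j => f (Pi.single j 1) := by
    intro x
    conv_lhs => rw [pi_eq_sum_univ' x]
    simp [dotProduct]
  refine ⟨fun j => f (Pi.single j 1), fun x hx => ?_, ?_⟩
  · rw [← key]
    exact hf x (subset_closure hx)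
  · rwa [← key]

/-- `cone G` as a pointed cone. -/
def pointedCone {ρ ι : Type} [Fintype ι] (G : Matrix ρ ι ℝ) : PointedCone ℝ (ρ → ℝ) where
  carrier := cone G
  add_mem' := by
    rintro _ _ ⟨α, hα, rfl⟩ ⟨β, hβ, rfl⟩
    exact ⟨α + β, fun j => add_nonneg (hα j) (hβ j), (Matrix.mulVec_add _ _ _).symm⟩
  zero_mem' := ⟨0, fun _ => le_rfl, by simp⟩
  smul_mem' := by
    rintro c _ ⟨α, hα, rfl⟩
    refine ⟨(c : ℝ) • α, fun j => mul_nonneg c.2 (hα j), ?_⟩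
    rw [Matrix.mulVec_smul]
    rfl

/-- Conic Carathéodory theorem. -/
lemma exists_linearIndepOn_of_mem_cone {ρ ι : Type} [Fintype ι] (G : Matrix ρ ι ℝ) {x : ρ → ℝ}
    (hx : x ∈ cone G) :
    ∃ α : ι → ℝ, (∀ j, 0 ≤ α j) ∧ x = G *ᵥ α ∧
      ∀ β : ι → ℝ, (∀ j, α j = 0 → β j = 0) → G *ᵥ β = 0 → β = 0 := by
  classical
  -- Choose a representation with the fewest nonzero coefficients; a nonzero kernel vector supported
  -- there would allow one with fewer.
  obtain ⟨α, ⟨hα, hxα⟩, hmin⟩ := exists_minimalFor_of_wellFoundedLT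
    (fun α : ι → ℝ => (∀ j, 0 ≤ α j) ∧ x = G *ᵥ α)
    (fun α => (Finset.univ.filter fun j => α j ≠ 0).card) hx
  refine ⟨α, hα, hxα, fun β hβ hGβ => ?_⟩
  by_contra hne
  wlog hpos : ∃ j, 0 < β j generalizing β
  · refine this (-β) (fun j hj => by simp [hβ j hj]) (by simp [Matrix.mulVec_neg, hGβ])
      (by simpa using hne) ?_
    obtain ⟨j, hj⟩ := Function.ne_iff.1 hne
    push Not at hpos
    exact ⟨j, by simpa using lt_of_le_of_ne (hpos j) hj⟩
  obtain ⟨j₁, hj₁⟩ := hpos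
  -- Ratio test: the smallest quotient is the largest multiple of `β` that can be subtracted from
  -- `α` within the orthant, and it kills the coordinate `j₀`.
  obtain ⟨j₀, hj₀, hle⟩ := Finset.exists_min_image (Finset.univ.filter fun j => 0 < β j)
    (fun j => α j / β j) ⟨j₁, by simpa using hj₁⟩
  simp only [Finset.mem_filter, Finset.mem_univ, true_and] at hj₀ hle
  set t := α j₀ / β j₀ with ht
  have ht0 : 0 ≤ t := div_nonneg (hα _) hj₀.le
  have h1 : (∀ j, 0 ≤ (α - t • β) j) ∧ x = G *ᵥ (α - t • β) := by
    refine ⟨fun j => ?_, by rw [Matrix.mulVec_sub, Matrix.mulVec_smul, hGβ, hxα]; simp⟩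
    simp only [Pi.sub_apply, Pi.smul_apply, smul_eq_mul, sub_nonneg]
    rcases lt_or_ge 0 (β j) with h | h
    · exact (le_div_iff₀ h).1 (hle j h)
    · exact (mul_nonpos_of_nonneg_of_nonpos ht0 h).trans (hα j)
  have hlt : (Finset.univ.filter fun j => (α - t • β) j ≠ 0).card <
      (Finset.univ.filter fun j => α j ≠ 0).card := by
    apply Finset.card_lt_card
    refine Finset.ssubset_iff_subset_ne.2 ⟨fun j => ?_, fun h => ?_⟩
    · simp only [Finset.mem_filter, Finset.mem_univ, true_and]
      intro h h0
      exact h (by simp [h0, hβ j h0])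
    · have : j₀ ∈ Finset.univ.filter fun j => α j ≠ 0 := by
        simp only [Finset.mem_filter, Finset.mem_univ, true_and]
        exact fun h0 => hj₀.ne' (hβ _ h0)
      rw [← h] at this
      simp only [Finset.mem_filter, Finset.mem_univ, true_and] at this
      apply this
      simp [ht, hj₀.ne']
  exact absurd (hmin h1 hlt.le) (not_le.2 hlt)

/-- By Carathéodory the cone is a finite union, over supports on which `G` is injective, of images
of closed orthants under injective linear maps, which are closed embeddings in finite dimension. -/
lemma isClosed_cone {ρ ι : Type} [Fintype ρ] [Fintype ι] (G : Matrix ρ ι ℝ) :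
    IsClosed (cone G) := by
  classical
  let W : Finset ι → Submodule ℝ (ι → ℝ) := fun s => Submodule.pi {j | j ∉ s} fun _ => ⊥
  let S : Set (Finset ι) := {s | ∀ β ∈ W s, G *ᵥ β = 0 → β = 0}
  have hW : ∀ s (β : ι → ℝ), β ∈ W s ↔ ∀ j, j ∉ s → β j = 0 := fun s β => by
    simp [W, Submodule.mem_pi]
  have : cone G = ⋃ s ∈ S,
      (G.mulVecLin ∘ₗ (W s).subtype) '' {β | ∀ j, 0 ≤ (β : ι → ℝ) j} := by
    ext x
    simp only [Set.mem_iUnion, Set.mem_image]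
    constructor
    · intro hx
      obtain ⟨α, hα, rfl, h⟩ := exists_linearIndepOn_of_mem_cone G hx
      refine ⟨Finset.univ.filter fun j => α j ≠ 0, fun β hβ => h β fun j hj => ?_,
        ⟨α, (hW _ _).2 fun j => ?_⟩, hα, rfl⟩
      · exact (hW _ _).1 hβ j (by simpa using hj)
      · simp
    · rintro ⟨s, -, β, hβ, rfl⟩
      exact ⟨β, hβ, rfl⟩
  rw [this]
  refine Set.Finite.isClosed_biUnion (Set.toFinite _) fun s hs => ?_
  refine (LinearMap.isClosedEmbedding_of_injective (LinearMap.ker_eq_bot'.2 ?_)).isClosedMap _ ?_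
  · intro β hβ
    exact Subtype.ext (hs β β.2 hβ)
  · rw [Set.ofPred_forall]
    exact isClosed_iInter fun j => isClosed_le continuous_const
      ((continuous_apply j).comp continuous_subtype_val)

/-- Farkas' lemma: a finitely generated cone is closed, so separation from the closure is separation
from the cone itself. -/
lemma exists_dotProduct_neg_of_notMem_cone {ρ ι : Type} [Fintype ρ] [Fintype ι]
    (G : Matrix ρ ι ℝ) {v : ρ → ℝ} (hv : v ∉ cone G) :
    ∃ η : ρ → ℝ, (∀ j, 0 ≤ G.col j ⬝ᵥ η) ∧ v ⬝ᵥ η < 0 := by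
  classical
  obtain ⟨η, h, h'⟩ := exists_dotProduct_neg_of_notMem_closure (pointedCone G) (v := v)
    (by rwa [show (pointedCone G : Set (ρ → ℝ)) = cone G from rfl, (isClosed_cone G).closure_eq])
  refine ⟨η, fun j => h _ ⟨Pi.single j 1, fun i => ?_, by simp⟩, h'⟩
  by_cases hij : i = j
  · subst hij; simp
  · simp [hij]

lemma dotProduct_nonneg_of_mem_cone {ρ ι : Type} [Fintype ρ] [Fintype ι]
    {G : Matrix ρ ι ℝ} {v η : ρ → ℝ} (hη : ∀ j, 0 ≤ G.col j ⬝ᵥ η) (hv : v ∈ cone G) :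
    0 ≤ v ⬝ᵥ η := by
  obtain ⟨α, hα, rfl⟩ := hv
  rw [← Matrix.vecMul_transpose, ← Matrix.dotProduct_mulVec]
  exact Finset.sum_nonneg fun j _ => mul_nonneg (hα j) (hη j)

/-- A linear map with finite-dimensional domain whose range is covered by an increasing family of
cones sends everything into one of them. -/
lemma exists_forall_mem_of_monotone_cones {E : Type*} [AddCommGroup E] [Module ℝ E] {n : ℕ}
    (C : ℝ → PointedCone ℝ E) (hC : ∀ s t, 0 ≤ s → s ≤ t → C s ≤ C t)
    (P : (Fin n → ℝ) →ₗ[ℝ] E) (h : ∀ v, ∃ τ, 0 ≤ τ ∧ P v ∈ C τ) :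
    ∃ τ, 0 < τ ∧ ∀ v, P v ∈ C τ := by
  choose τ hτ hP using h
  let S : Fin n → ℝ := fun j => τ (Pi.single j 1) + τ (-Pi.single j 1)
  -- `T` dominates the times needed for all vectors `±e_j`, which generate the space as a cone; the
  -- summand `1` keeps it positive even when `n = 0`.
  let T : ℝ := 1 + ∑ j, S j
  have hS : ∀ j, S j ≤ T := fun j => by
    have := Finset.single_le_sum (f := S) (fun j _ => add_nonneg (hτ _) (hτ _))
      (Finset.mem_univ j)
    simp only [T]; linarith
  have hT : 0 < T := by
    have : 0 ≤ ∑ j, S j := Finset.sum_nonneg fun j _ => add_nonneg (hτ _) (hτ _)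
    simp only [T]; linarith
  refine ⟨T, hT, fun v => ?_⟩
  rw [pi_eq_sum_univ' v, map_sum]
  refine Submodule.sum_mem _ fun j _ => ?_
  rw [map_smul]
  rcases le_total 0 (v j) with hv | hv
  · exact (C T).smul_mem hv (hC _ _ (hτ _)
      ((le_add_of_nonneg_right (hτ _)).trans (hS j)) (hP (Pi.single j 1)))
  · have := (C T).smul_mem (neg_nonneg.2 hv) (hC _ _ (hτ _)
      ((le_add_of_nonneg_left (hτ _)).trans (hS j)) (hP (-Pi.single j 1)))
    rw [map_neg] at this
    convert! this using 1
    change _ = (-v j) • (-(P _))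
    simp

end RelArray

namespace RelArray

open Filter Topology

/-! ### Nonnegative exponential polynomials -/

lemma integrableOn_pow_mul_cexp (r : ℕ) {z : ℂ} (hz : z.re < 0) :
    IntegrableOn (fun t : ℝ => (t : ℂ) ^ r / (r.factorial : ℂ) * Complex.exp (z * t))
      (Set.Ioi 0) := by
  have h := (integrableOn_rpow_mul_exp_neg_mul_rpow (p := 1) (s := r) (b := -z.re)
    (lt_of_lt_of_le (by norm_num) (Nat.cast_nonneg r)) one_pos (by linarith)).div_const
      (r.factorial : ℝ)
  refine h.mono' (by fun_prop) ?_
  filter_upwards [ae_restrict_mem measurableSet_Ioi] with t ht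
  have ht' : (0 : ℝ) < t := ht
  simp [Complex.norm_exp, abs_of_pos ht', div_mul_eq_mul_div]

/-- Induction on `r`: the derivative of `t^{r+1}/(r+1)! e^{zt}` is the integrand of degree `r` plus
`z` times that of degree `r + 1`, and it integrates to zero because the function vanishes at both
ends. -/
lemma integral_pow_mul_cexp (r : ℕ) {z : ℂ} (hz : z.re < 0) :
    ∫ t : ℝ in Set.Ioi 0, (t : ℂ) ^ r / (r.factorial : ℂ) * Complex.exp (z * t) =
      1 / (-z) ^ (r + 1) := by
  have hz0 : z ≠ 0 := by rintro rfl; simp at hz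
  induction r with
  | zero =>
    have := integral_exp_mul_complex_Ioi hz 0
    simp only [pow_zero, Nat.factorial_zero, Nat.cast_one, div_one, one_mul]
    rw [this]
    simp [neg_div]
  | succ r ih =>
    have hd : ∀ t : ℝ, HasDerivAt
        (fun t : ℝ => (t : ℂ) ^ (r + 1) / ((r + 1).factorial : ℂ) * Complex.exp (z * t))
        ((t : ℂ) ^ r / (r.factorial : ℂ) * Complex.exp (z * t) +
          z * ((t : ℂ) ^ (r + 1) / ((r + 1).factorial : ℂ) * Complex.exp (z * t))) t := by
      intro t
      have h1 : HasDerivAt (fun t : ℂ => t ^ (r + 1) / ((r + 1).factorial : ℂ))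
          ((t : ℂ) ^ r / (r.factorial : ℂ)) t := by
        convert! (hasDerivAt_pow (r + 1) (t : ℂ)).div_const ((r + 1).factorial : ℂ) using 1
        rw [Nat.factorial_succ]
        have : ((r : ℂ) + 1) ≠ 0 := by exact_mod_cast r.succ_ne_zero
        have : (r.factorial : ℂ) ≠ 0 := by exact_mod_cast r.factorial_ne_zero
        push_cast
        field_simp
      have h2 : HasDerivAt (fun t : ℂ => Complex.exp (z * t)) (Complex.exp (z * t) * z) t := by
        simpa using ((hasDerivAt_id (t : ℂ)).const_mul z).cexp
      convert! (h1.mul h2).comp_ofReal using 1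
      ring
    have hi1 := integrableOn_pow_mul_cexp r hz
    have hi2 := integrableOn_pow_mul_cexp (r + 1) hz
    have hlim := tendsto_zero_of_hasDerivAt_of_integrableOn_Ioi (fun t _ => hd t)
      (hi1.add (hi2.const_mul z)) hi2
    have := integral_Ioi_of_hasDerivAt_of_tendsto' (fun t _ => hd t)
      (hi1.add (hi2.const_mul z)) hlim
    rw [integral_add hi1 (hi2.const_mul z), integral_const_mul, ih] at this
    simp only [Complex.ofReal_zero, ne_eq, Nat.add_eq_zero_iff, one_ne_zero, and_false,
      not_false_eq_true, zero_pow, zero_div, zero_mul, sub_zero] at this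
    have h3 : (-z) ≠ 0 := neg_ne_zero.2 hz0
    rw [pow_succ (-z) (r + 1)]
    refine mul_left_cancel₀ h3 ?_
    have h4 := eq_neg_of_add_eq_zero_left this
    rw [neg_mul, ← h4]
    field_simp

/-- The limit of `s ^ (d + 1) / (s + w) ^ (r + 1)` as `s` decreases to `0`. -/
lemma tendsto_pow_div_pow {w : ℂ} {r d : ℕ} (h : w = 0 → r ≤ d) :
    Tendsto (fun s : ℝ => (s : ℂ) ^ (d + 1) * (1 / ((s : ℂ) + w) ^ (r + 1))) (𝓝[>] 0)
      (𝓝 (if w = 0 ∧ r = d then 1 else 0)) := by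
  by_cases hw : w = 0
  · subst hw
    have hrd := h rfl
    have hne : ∀ᶠ s : ℝ in 𝓝[>] 0, (s : ℂ) ≠ 0 := by
      filter_upwards [self_mem_nhdsWithin] with s hs
      exact_mod_cast (ne_of_gt hs : s ≠ 0)
    have : Tendsto (fun s : ℝ => (s : ℂ) ^ (d - r)) (𝓝[>] 0) (𝓝 (((0 : ℝ) : ℂ) ^ (d - r))) :=
      ((Complex.continuous_ofReal.pow _).tendsto _).mono_left nhdsWithin_le_nhds
    have hval : (((0 : ℝ) : ℂ) ^ (d - r)) = if (0 : ℂ) = 0 ∧ r = d then 1 else 0 := by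
      rcases hrd.eq_or_lt with rfl | hlt
      · simp
      · simp [hlt.ne, Nat.sub_ne_zero_of_lt hlt]
    rw [← hval]
    refine this.congr' ?_
    filter_upwards [hne] with s hs
    rw [add_zero, show d + 1 = (d - r) + (r + 1) by omega, pow_add]
    field_simp
  · have hc : ContinuousAt (fun s : ℝ => (s : ℂ) ^ (d + 1) * (1 / ((s : ℂ) + w) ^ (r + 1))) 0 := by
      refine ContinuousAt.mul (by fun_prop) (ContinuousAt.div (by fun_prop) (by fun_prop) ?_)
      simp [hw]
    have := hc.tendsto.mono_left (nhdsWithin_le_nhds (s := Set.Ioi 0))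
    simpa [hw] using this

/-- In a nonnegative exponential polynomial whose exponents have real part at most `α`, the
coefficients of top degree at the exponents on the line `Re = α` are dominated by the coefficient
at `α` itself. -/
theorem norm_coeff_le_of_nonneg {ι : Type*} [Fintype ι] (μ : ι → ℂ) (N : ℕ) (a : ι → ℕ → ℂ)
    (ha : ∀ ν, ∀ r, N ≤ r → a ν r = 0) (g : ℝ → ℝ) (hg : ∀ t, 0 ≤ t → 0 ≤ g t)
    (hf : ∀ t, 0 ≤ t → (g t : ℂ) = ∑ ν, ∑ r ∈ Finset.range N,
      a ν r * ((t : ℂ) ^ r / (r.factorial : ℂ) * Complex.exp (μ ν * t)))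
    (α : ℝ) (hα : ∀ ν, α < (μ ν).re → ∀ r, a ν r = 0) (d : ℕ)
    (hd : ∀ ν, (μ ν).re = α → ∀ r, d < r → a ν r = 0) (ω : ℝ) :
    ‖∑ ν, if μ ν = α + ω * Complex.I then a ν d else 0‖ ≤
      (∑ ν, if μ ν = α then a ν d else 0).re := by
  classical
  -- the Laplace transform on the line `Im = ω`
  let F : ℝ → ℝ → ℝ → ℂ := fun ω s t => Complex.exp (-(α + s + ω * Complex.I) * t) * g t
  have hF : ∀ ω s t, 0 ≤ t → F ω s t = ∑ ν, ∑ r ∈ Finset.range N,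
      a ν r * ((t : ℂ) ^ r / (r.factorial : ℂ) *
        Complex.exp ((μ ν - (α + s + ω * Complex.I)) * t)) := by
    intro ω s t ht
    simp only [F, hf t ht, Finset.mul_sum]
    refine Finset.sum_congr rfl fun ν _ => Finset.sum_congr rfl fun r _ => ?_
    rw [show (μ ν - (α + s + ω * Complex.I)) * (t : ℂ) =
      -(α + s + ω * Complex.I) * t + μ ν * t by ring, Complex.exp_add]
    ring
  -- Exponents to the right of the line `Re = α` carry no coefficients, so every term of the
  -- transform converges for `s > 0`.
  have hre : ∀ ω s : ℝ, 0 < s → ∀ ν, (∀ r, a ν r = 0) ∨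
      (μ ν - (α + s + ω * Complex.I)).re < 0 := by
    intro ω s hs ν
    rcases lt_or_ge α (μ ν).re with h | h
    · exact Or.inl (hα ν h)
    · right; simp; linarith
  have hterm : ∀ ω s : ℝ, 0 < s → ∀ ν r, IntegrableOn (fun t : ℝ =>
      a ν r * ((t : ℂ) ^ r / (r.factorial : ℂ) *
        Complex.exp ((μ ν - (α + s + ω * Complex.I)) * t))) (Set.Ioi 0) := by
    intro ω s hs ν r
    rcases hre ω s hs ν with h | h
    · simp [h]
    · exact (integrableOn_pow_mul_cexp r h).const_mul _
  have hFeq : ∀ ω s, Set.EqOn (F ω s) (fun t => ∑ ν, ∑ r ∈ Finset.range N,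
      a ν r * ((t : ℂ) ^ r / (r.factorial : ℂ) *
        Complex.exp ((μ ν - (α + s + ω * Complex.I)) * t))) (Set.Ioi 0) :=
    fun ω s t ht => hF ω s t (le_of_lt ht)
  have hint : ∀ ω s : ℝ, 0 < s → ∫ t in Set.Ioi 0, F ω s t =
      ∑ ν, ∑ r ∈ Finset.range N, a ν r * (1 / ((s : ℂ) + (α + ω * Complex.I - μ ν)) ^ (r + 1)) := by
    intro ω s hs
    rw [setIntegral_congr_fun measurableSet_Ioi (hFeq ω s), integral_finsetSum _ fun ν _ =>
      integrable_finsetSum _ fun r _ => hterm ω s hs ν r]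
    refine Finset.sum_congr rfl fun ν _ => ?_
    rw [integral_finsetSum _ fun r _ => hterm ω s hs ν r]
    refine Finset.sum_congr rfl fun r _ => ?_
    rcases hre ω s hs ν with h | h
    · simp [h]
    · rw [integral_const_mul, integral_pow_mul_cexp r h]
      congr 3
      ring
  -- The factor `s^{d+1}` isolates the pole of order `d + 1` at `α + iω`: lower poles are killed,
  -- and higher ones are excluded by `hd`.
  have hlim : ∀ ω : ℝ, Tendsto (fun s : ℝ => (s : ℂ) ^ (d + 1) * ∫ t in Set.Ioi 0, F ω s t)
      (𝓝[>] 0) (𝓝 (∑ ν, if μ ν = α + ω * Complex.I then a ν d else 0)) := by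
    intro ω
    have h1 : ∀ ν, ∀ r ∈ Finset.range N, Tendsto (fun s : ℝ => a ν r * ((s : ℂ) ^ (d + 1) *
        (1 / ((s : ℂ) + (α + ω * Complex.I - μ ν)) ^ (r + 1)))) (𝓝[>] 0)
        (𝓝 (if μ ν = α + ω * Complex.I ∧ r = d then a ν r else 0)) := by
      intro ν r _
      by_cases h : μ ν = α + ω * Complex.I ∧ d < r
      · have : a ν r = 0 := hd ν (by simp [h.1]) r h.2
        simp [this]
      · have := (tendsto_pow_div_pow (w := α + ω * Complex.I - μ ν) (r := r) (d := d)
          (fun h0 => not_lt.1 fun hlt => h ⟨(sub_eq_zero.1 h0).symm, hlt⟩)).const_mul (a ν r)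
        convert! this using 2
        simp [sub_eq_zero, eq_comm]
    have h2 := tendsto_finsetSum Finset.univ fun ν _ =>
      tendsto_finsetSum (Finset.range N) (h1 ν)
    have h3 : (∑ ν, ∑ r ∈ Finset.range N,
        if μ ν = α + ω * Complex.I ∧ r = d then a ν r else 0) =
        ∑ ν, if μ ν = α + ω * Complex.I then a ν d else 0 := by
      refine Finset.sum_congr rfl fun ν _ => ?_
      by_cases h : μ ν = α + ω * Complex.I
      · simp only [h, true_and, if_true, Finset.sum_ite_eq', Finset.mem_range]
        split_ifs with hN
        · rfl
        · exact (ha ν d (not_lt.1 hN)).symm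
      · simp [h]
    rw [← h3]
    refine h2.congr' ?_
    filter_upwards [self_mem_nhdsWithin] with s hs
    rw [hint ω s hs, Finset.mul_sum]
    refine Finset.sum_congr rfl fun ν _ => ?_
    rw [Finset.mul_sum]
    refine Finset.sum_congr rfl fun r _ => ?_
    ring
  -- The only use of `g ≥ 0`: the modulus of the integrand does not depend on `ω`, and for `ω = 0`
  -- the integrand equals its modulus.
  have hnorm : ∀ ω s t : ℝ, 0 ≤ t → ‖F ω s t‖ = (F 0 s t).re := by
    intro ω s t ht
    have h0 : F 0 s t = ((Real.exp (-(α + s) * t) * g t : ℝ) : ℂ) := by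
      simp [F]
    rw [h0, Complex.ofReal_re]
    simp [F, Complex.norm_exp, abs_of_nonneg (hg t ht)]
  have hFint : ∀ ω s : ℝ, 0 < s → IntegrableOn (F ω s) (Set.Ioi 0) := fun ω s hs =>
    (integrableOn_congr_fun (hFeq ω s) measurableSet_Ioi).2
      (integrable_finsetSum _ fun ν _ => integrable_finsetSum _ fun r _ => hterm ω s hs ν r)
  have hle : ∀ᶠ s : ℝ in 𝓝[>] 0, ‖(s : ℂ) ^ (d + 1) * ∫ t in Set.Ioi 0, F ω s t‖ ≤
      ((s : ℂ) ^ (d + 1) * ∫ t in Set.Ioi 0, F 0 s t).re := by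
    filter_upwards [self_mem_nhdsWithin] with s hs
    have hs0 : (0 : ℝ) < s := hs
    rw [← Complex.ofReal_pow, Complex.re_ofReal_mul, norm_mul, Complex.norm_real, Real.norm_eq_abs,
      abs_of_pos (pow_pos hs0 _)]
    refine mul_le_mul_of_nonneg_left ?_ (pow_pos hs0 _).le
    have h5 : (∫ t in Set.Ioi 0, F 0 s t).re = ∫ t in Set.Ioi 0, (F 0 s t).re :=
      (integral_re (hFint 0 s hs0)).symm
    rw [h5]
    refine (norm_integral_le_integral_norm _).trans (le_of_eq ?_)
    exact setIntegral_congr_fun measurableSet_Ioi fun t ht => hnorm ω s t (le_of_lt ht)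
  have := le_of_tendsto_of_tendsto (hlim ω).norm
    ((Complex.continuous_re.tendsto _).comp (hlim 0)) hle
  simpa using this

end RelArray

namespace RelArray

open Filter Topology

/-- If the real coefficients vanish from degree `d` on, then so do all coefficients at exponents
with the same real part. -/
theorem coeff_eq_zero_of_nonneg {ι : Type*} [Fintype ι] (μ : ι → ℂ) (N : ℕ) (a : ι → ℕ → ℂ)
  (ha : ∀ ν, ∀ r, N ≤ r → a ν r = 0) (g : ℝ → ℝ) (hg : ∀ t, 0 ≤ t → 0 ≤ g t)
  (hf : ∀ t, 0 ≤ t → (g t : ℂ) = ∑ ν, ∑ r ∈ Finset.range N,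
    a ν r * ((t : ℂ) ^ r / (r.factorial : ℂ) * Complex.exp (μ ν * t)))
  (α : ℝ) (hα : ∀ ν, α < (μ ν).re → ∀ r, a ν r = 0)
    (hμ : Function.Injective μ) (d : ℕ)
    (hd : ∀ r, d ≤ r → (∑ ν, if μ ν = α then a ν r else 0).re = 0) (ν : ι)
    (hν : (μ ν).re = α) (r : ℕ) (hr : d ≤ r) : a ν r = 0 := by
  classical
  -- Downward induction on the degree; `j` bounds the distance from `d` to `N`, beyond which all
  -- coefficients vanish.
  obtain ⟨j, hj⟩ : ∃ j, N ≤ d + j := ⟨N, Nat.le_add_left _ _⟩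
  induction j generalizing d r ν with
  | zero => exact ha ν r (by omega)
  | succ j ih =>
    have hnext := ih (d + 1) (fun r hr => hd r (by omega))
    rcases hr.eq_or_lt with rfl | hlt
    · have := norm_coeff_le_of_nonneg μ N a ha g hg hf α hα d
        (fun ν hν r hr => hnext ν hν r hr (by omega)) (μ ν).im
      rw [hd d le_rfl, ← hν, Complex.re_add_im] at this
      simpa [hμ.eq_iff] using this
    · exact hnext ν hν r hlt (by omega)

/-- The leading coefficient at the dominating real exponent is nonnegative. -/
theorem leading_coeff_nonneg_of_nonneg {ι : Type*} [Fintype ι] (μ : ι → ℂ) (N : ℕ) (a : ι → ℕ → ℂ)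
  (ha : ∀ ν, ∀ r, N ≤ r → a ν r = 0) (g : ℝ → ℝ) (hg : ∀ t, 0 ≤ t → 0 ≤ g t)
  (hf : ∀ t, 0 ≤ t → (g t : ℂ) = ∑ ν, ∑ r ∈ Finset.range N,
    a ν r * ((t : ℂ) ^ r / (r.factorial : ℂ) * Complex.exp (μ ν * t)))
  (α : ℝ) (hα : ∀ ν, α < (μ ν).re → ∀ r, a ν r = 0)
    (hμ : Function.Injective μ) (d : ℕ)
    (hd : ∀ r, d + 1 ≤ r → (∑ ν, if μ ν = α then a ν r else 0).re = 0) :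
    0 ≤ (∑ ν, if μ ν = α then a ν d else 0).re :=
  (norm_nonneg _).trans (norm_coeff_le_of_nonneg μ N a ha g hg hf α hα d
    (fun ν hν r hr => coeff_eq_zero_of_nonneg μ N a ha g hg hf α hα hμ (d + 1) hd ν hν r hr) 0)

/-! ### Signs of real polynomials at infinity -/

lemma tendsto_sum_pow_div_pow (b : ℕ → ℝ) (N : ℕ) :
    Tendsto (fun t : ℝ => (∑ s ∈ Finset.range (N + 1), t ^ s / (s.factorial : ℝ) * b s) / t ^ N)
      atTop (𝓝 (b N / N.factorial)) := by
  have h1 : ∀ s ∈ Finset.range (N + 1), Tendsto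
      (fun t : ℝ => t ^ s / (s.factorial : ℝ) * b s / t ^ N) atTop
      (𝓝 (if s = N then b N / N.factorial else 0)) := by
    intro s hs
    by_cases h : s = N
    · subst h
      simp only [if_true]
      refine tendsto_const_nhds.congr' ?_
      filter_upwards [eventually_gt_atTop 0] with t ht
      field_simp
    · have hlt : s < N := by simp at hs; omega
      have := (tendsto_pow_div_pow_atTop_zero (𝕜 := ℝ) hlt).mul_const (b s / s.factorial)
      simp only [h, if_false]
      rw [zero_mul] at this
      refine this.congr fun t => ?_
      ring
  have := tendsto_finsetSum _ h1
  simp only [Finset.sum_ite_eq', Finset.mem_range, Nat.lt_succ_self, if_true] at this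
  refine this.congr fun t => ?_
  rw [Finset.sum_div]

/-- The leading coefficient decides the sign for large `t`. `H` makes it nonnegative; if it is zero,
the degree drops and the induction continues. -/
lemma eventually_sum_pow_nonneg (b : ℕ → ℝ) (N : ℕ) (hN : ∀ s, N ≤ s → b s = 0)
    (H : ∀ d, (∀ s, d + 1 ≤ s → b s = 0) → 0 ≤ b d) :
    ∀ᶠ t : ℝ in atTop, 0 ≤ ∑ s ∈ Finset.range N, t ^ s / (s.factorial : ℝ) * b s := by
  induction N with
  | zero => simp
  | succ N ih =>
    rcases (H N hN).eq_or_lt with h | h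
    · have h0 : ∀ s, N ≤ s → b s = 0 := fun s hs => by
        rcases hs.eq_or_lt with rfl | hs
        · exact h.symm
        · exact hN s hs
      filter_upwards [ih h0] with t ht
      rwa [Finset.sum_range_succ, ← h, mul_zero, add_zero]
    · have h1 := tendsto_sum_pow_div_pow b N
      have h2 : 0 < b N / N.factorial := div_pos h (by exact_mod_cast N.factorial_pos)
      filter_upwards [h1.eventually (lt_mem_nhds h2), eventually_gt_atTop 0] with t ht ht0
      exact ((div_pos_iff_of_pos_right (pow_pos ht0 N)).1 ht).le

end RelArray

namespace RelArray

open Filter Topology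

/-! ### Matrix exponentials -/

section
open scoped Matrix.Norms.Operator

lemma exp_smul_mulVec_of_pow_mulVec_eq_zero {𝕜 : Type*} [RCLike 𝕜] {m : Type*} [Fintype m]
    [DecidableEq m] (M : Matrix m m 𝕜) (v : m → 𝕜) (K : ℕ) (h : ∀ r, K ≤ r → M ^ r *ᵥ v = 0)
    (t : 𝕜) : NormedSpace.exp (t • M) *ᵥ v =
      ∑ r ∈ Finset.range K, (t ^ r / (r.factorial : 𝕜)) • (M ^ r *ᵥ v) := by
  have h1 : HasSum (fun r : ℕ => (r.factorial⁻¹ : 𝕜) • (t • M) ^ r) (NormedSpace.exp (t • M)) :=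
    NormedSpace.exp_series_hasSum_exp' (𝕂 := 𝕜) (t • M)
  let L : Matrix m m 𝕜 →+ (m → 𝕜) :=
    { toFun := fun X => X *ᵥ v, map_zero' := by simp, map_add' := fun X Y => Matrix.add_mulVec X Y v }
  have hL : Continuous L := Continuous.matrix_mulVec continuous_id continuous_const
  have h2 := h1.map L hL
  refine h2.unique ?_
  have h3 : ∀ r : ℕ, (L ∘ fun r : ℕ => (r.factorial⁻¹ : 𝕜) • (t • M) ^ r) r =
      (t ^ r / (r.factorial : 𝕜)) • (M ^ r *ᵥ v) := by
    intro r
    change ((r.factorial⁻¹ : 𝕜) • (t • M) ^ r) *ᵥ v = _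
    rw [smul_pow, smul_smul, Matrix.smul_mulVec]
    congr 1
    ring
  rw [← Finset.sum_congr rfl fun r _ => h3 r]
  refine hasSum_sum_of_ne_finset_zero fun r hr => ?_
  rw [h3, h r (by simpa using hr), smul_zero]

lemma continuous_exp_smul {𝕜 : Type*} [RCLike 𝕜] {m : Type*} [Fintype m] [DecidableEq m]
    (M : Matrix m m 𝕜) : Continuous fun t : ℝ => NormedSpace.exp (t • M) :=
  NormedSpace.exp_continuous.comp (by fun_prop)

lemma exp_map_ofReal {m : Type*} [Fintype m] [DecidableEq m] (M : Matrix m m ℝ) :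
    NormedSpace.exp (M.map Complex.ofReal) = (NormedSpace.exp M).map Complex.ofReal :=
  (NormedSpace.map_exp (Complex.ofRealHom.mapMatrix : Matrix m m ℝ →+* Matrix m m ℂ)
    (continuous_id.matrix_map Complex.continuous_ofReal) M).symm

lemma exp_bigA {q n : ℕ} (A : Matrix (Fin n) (Fin n) ℝ) :
    NormedSpace.exp (bigA q A) = bigA q (NormedSpace.exp A) := by
  let f : Matrix (Fin n) (Fin n) ℝ →+* Matrix (Fin q × Fin n) (Fin q × Fin n) ℝ :=
    { toFun := bigA q
      map_one' := Matrix.one_kronecker_one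
      map_mul' := fun X Y => by simp [bigA, ← Matrix.mul_kronecker_mul]
      map_zero' := Matrix.kronecker_zero _
      map_add' := fun X Y => Matrix.kronecker_add _ _ _ }
  have hf : Continuous f := by
    refine continuous_matrix fun i j => ?_
    change Continuous fun X : Matrix (Fin n) (Fin n) ℝ =>
      (1 : Matrix (Fin q) (Fin q) ℝ) i.1 j.1 * X i.2 j.2
    fun_prop
  exact (NormedSpace.map_exp f hf A).symm

end

lemma exp_add_smul {𝕜 : Type*} [RCLike 𝕜] {m : Type*} [Fintype m] [DecidableEq m]
    (M : Matrix m m 𝕜) (s t : ℝ) :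
    NormedSpace.exp ((s + t) • M) = NormedSpace.exp (s • M) * NormedSpace.exp (t • M) := by
  rw [add_smul, Matrix.exp_add_of_commute]
  exact ((Commute.refl M).smul_left s).smul_right t

lemma exp_neg_smul_mul_exp_smul {𝕜 : Type*} [RCLike 𝕜] {m : Type*} [Fintype m] [DecidableEq m]
    (M : Matrix m m 𝕜) (t : ℝ) :
    NormedSpace.exp ((-t) • M) * NormedSpace.exp (t • M) = 1 := by
  rw [← exp_add_smul]; simp

lemma exp_smul_mulVec_injective {𝕜 : Type*} [RCLike 𝕜] {m : Type*} [Fintype m] [DecidableEq m]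
    (M : Matrix m m 𝕜) (t : ℝ) :
    Function.Injective fun v : m → 𝕜 => NormedSpace.exp (t • M) *ᵥ v := fun v w h => by
  have := congrArg (fun x => NormedSpace.exp ((-t) • M) *ᵥ x) h
  simpa only [Matrix.mulVec_mulVec, exp_neg_smul_mul_exp_smul, Matrix.one_mulVec] using this

/-! ### Spectral decomposition -/

namespace SpectralData

variable {q p n : ℕ} {A : Matrix (Fin n) (Fin n) ℝ} (D : SpectralData A)

lemma mult_le (κ : Fin D.m) : D.mult κ ≤ n := by
  have h : (adj A).charpoly.rootMultiplicity (D.μ κ) ≤ (adj A).charpoly.natDegree := by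
    rw [← Polynomial.count_roots]
    exact (Multiset.count_le_card _ _).trans (Polynomial.card_roots' _)
  simpa [mult, algMult, Matrix.charpoly_natDegree_eq_dim] using h

lemma U_mulVec_injective (κ : Fin D.m) : Function.Injective (D.U κ).mulVec :=
  Matrix.mulVec_injective_iff.2 (D.U_linearIndependent κ)

lemma Lam_conjTranspose (κ : Fin D.m) : (D.Lam κ)ᴴ = (D.Ared κ)ᴴ - D.μ κ • 1 := by
  simp [Lam]

/-- In the basis `U_κ`, the operator `A* - μ_κ` acts as `Λ_κ*`. -/
lemma pow_mul_U (κ : Fin D.m) (r : ℕ) :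
    (adj A - D.μ κ • (1 : Matrix (Fin n) (Fin n) ℂ)) ^ r * D.U κ =
      D.U κ * (D.Lam κ)ᴴ ^ r := by
  induction r with
  | zero => simp
  | succ r ih =>
    rw [pow_succ', Matrix.mul_assoc, ih, ← Matrix.mul_assoc, Matrix.sub_mul, D.Ared_spec,
      pow_succ', ← Matrix.mul_assoc, Lam_conjTranspose, Matrix.mul_sub]
    simp

/-- The power `n_κ` of `A* - μ_κ` kills the range of `U_κ`, and `U_κ` is injective. -/
lemma Lam_conjTranspose_pow_eq_zero (κ : Fin D.m) {r : ℕ} (hr : D.mult κ ≤ r) :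
    (D.Lam κ)ᴴ ^ r = 0 := by
  have h : D.U κ * (D.Lam κ)ᴴ ^ (D.mult κ) = 0 := by
    rw [← pow_mul_U]
    refine Matrix.ext_of_mulVec_single fun j => ?_
    rw [← Matrix.mulVec_mulVec, Matrix.zero_mulVec]
    have : (D.U κ) *ᵥ Pi.single j 1 ∈ LinearMap.range (D.U κ).mulVecLin := ⟨_, rfl⟩
    rw [D.U_range] at this
    exact this
  have h0 : (D.Lam κ)ᴴ ^ (D.mult κ) = 0 := by
    refine Matrix.ext_of_mulVec_single fun j => D.U_mulVec_injective κ ?_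
    rw [Matrix.mulVec_mulVec, h]
    simp only [Matrix.zero_mulVec, Matrix.mulVec_zero]
  exact pow_eq_zero_of_le hr h0

lemma Lam_pow_eq_zero (κ : Fin D.m) {r : ℕ} (hr : D.mult κ ≤ r) : D.Lam κ ^ r = 0 := by
  have := congrArg Matrix.conjTranspose (D.Lam_conjTranspose_pow_eq_zero κ hr)
  simpa [Matrix.conjTranspose_pow] using this

/-- Evolution of a generalized eigenvector. -/
lemma exp_mulVec_U (κ : Fin D.m) (z : Fin (D.mult κ) → ℂ) (t : ℝ) :
    NormedSpace.exp (t • adj A) *ᵥ (D.U κ *ᵥ z) = ∑ r ∈ Finset.range n,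
      ((t : ℂ) ^ r / (r.factorial : ℂ) * Complex.exp (D.μ κ * t)) •
        (D.U κ *ᵥ ((D.Lam κ)ᴴ ^ r *ᵥ z)) := by
  set M := adj A - D.μ κ • (1 : Matrix (Fin n) (Fin n) ℂ) with hM
  have h1 : t • adj A = (t : ℂ) • M + ((D.μ κ * t) • (1 : Matrix (Fin n) (Fin n) ℂ)) := by
    rw [hM, smul_sub, smul_smul, mul_comm (t : ℂ), sub_add_cancel]
    ext i j; simp
  have h2 : NormedSpace.exp ((D.μ κ * t) • (1 : Matrix (Fin n) (Fin n) ℂ)) =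
      Complex.exp (D.μ κ * t) • 1 := by
    rw [Matrix.smul_one_eq_diagonal, Matrix.exp_diagonal, Matrix.smul_one_eq_diagonal]
    congr 1
    ext i
    rw [Pi.coe_exp, Complex.exp_eq_exp_ℂ]
  rw [h1, Matrix.exp_add_of_commute _ _ ((Commute.one_right _).smul_right _), h2,
    Matrix.mul_smul, Matrix.mul_one, Matrix.smul_mulVec,
    exp_smul_mulVec_of_pow_mulVec_eq_zero M _ n, Finset.smul_sum]
  · refine Finset.sum_congr rfl fun r _ => ?_
    rw [smul_smul, Matrix.mulVec_mulVec, pow_mul_U, ← Matrix.mulVec_mulVec, mul_comm]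
  · intro r hr
    rw [Matrix.mulVec_mulVec, pow_mul_U,
      D.Lam_conjTranspose_pow_eq_zero κ ((D.mult_le κ).trans hr)]
    simp

/-- One inclusion is immediate and the dimensions agree: both are the algebraic multiplicity. -/
lemma range_U_eq_maxGenEigenspace (κ : Fin D.m) :
    LinearMap.range (D.U κ).mulVecLin =
      Module.End.maxGenEigenspace (Matrix.toLin' (adj A)) (D.μ κ) := by
  have hle : LinearMap.range (D.U κ).mulVecLin ≤
      Module.End.maxGenEigenspace (Matrix.toLin' (adj A)) (D.μ κ) := by
    rw [D.U_range]
    intro v hv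
    rw [Module.End.mem_maxGenEigenspace]
    refine ⟨algMult A (D.μ κ), ?_⟩
    have h : (Matrix.toLin' (adj A) - D.μ κ • 1) =
        Matrix.toLin' (adj A - D.μ κ • (1 : Matrix (Fin n) (Fin n) ℂ)) := by
      rw [map_sub, map_smul, Matrix.toLin'_one]; rfl
    rw [h, ← Matrix.toLin'_pow]
    exact hv
  refine Submodule.eq_of_le_of_finrank_eq hle ?_
  rw [LinearMap.finrank_maxGenEigenspace_eq, Matrix.charpoly_toLin',
    LinearMap.finrank_range_of_inj (D.U_mulVec_injective κ)]
  exact Module.finrank_fin_fun ℂ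

lemma exists_eq_sum_U_mulVec (v : Fin n → ℂ) :
    ∃ ζ : ∀ κ, Fin (D.mult κ) → ℂ, v = ∑ κ, D.U κ *ᵥ ζ κ := by
  have h := Module.End.iSup_maxGenEigenspace_eq_top (Matrix.toLin' (adj A))
  let L : (∀ κ, Fin (D.mult κ) → ℂ) →ₗ[ℂ] Fin n → ℂ :=
    ∑ κ, (D.U κ).mulVecLin ∘ₗ LinearMap.proj κ
  have hL : ∀ ζ, L ζ = ∑ κ, D.U κ *ᵥ ζ κ := fun ζ => by simp [L]
  have h2 : LinearMap.range L = ⊤ := by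
    rw [eq_top_iff, ← h]
    refine iSup_le fun z => ?_
    by_cases hz : Module.End.HasEigenvalue (Matrix.toLin' (adj A)) z
    · obtain ⟨κ, rfl⟩ := (D.μ_range z).2 hz
      rw [← range_U_eq_maxGenEigenspace]
      rintro _ ⟨y, rfl⟩
      refine ⟨Pi.single κ y, ?_⟩
      rw [hL, Finset.sum_eq_single κ (fun ν _ hν => by simp [hν]) (by simp)]
      simp
    · have : Module.End.maxGenEigenspace (Matrix.toLin' (adj A)) z = ⊥ := by
        by_contra hne
        exact hz (Module.End.HasUnifEigenvalue.lt one_pos hne)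
      rw [this]
      exact bot_le
  obtain ⟨ζ, hζ⟩ := LinearMap.range_eq_top.1 h2 v
  exact ⟨ζ, by rw [← hL, hζ]⟩

end SpectralData

end RelArray

namespace RelArray

open Filter Topology

/-! ### Outputs of the adjoint system -/

variable {q p n : ℕ}

/-- The output `∑_i ⟨B_{iσ}, e^{tA*} η_i⟩` of the adjoint system. -/
def output (A : Matrix (Fin n) (Fin n) ℝ) (B : Fin q → Fin p → Fin n → ℝ)
    (η : Fin q → Fin n → ℝ) (σ : Fin p) (t : ℝ) : ℝ :=
  ∑ i, B i σ ⬝ᵥ (NormedSpace.exp (t • Aᵀ) *ᵥ η i)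

/-- The output of the adjoint system at a complex initial state. -/
def outputC (A : Matrix (Fin n) (Fin n) ℝ) (B : Fin q → Fin p → Fin n → ℝ)
    (η : Fin q → Fin n → ℂ) (σ : Fin p) (t : ℝ) : ℂ :=
  ∑ i, (fun a => (B i σ a : ℂ)) ⬝ᵥ (NormedSpace.exp (t • adj A) *ᵥ η i)

variable {A : Matrix (Fin n) (Fin n) ℝ} (B : Fin q → Fin p → Fin n → ℝ)

lemma exp_smul_adj (A : Matrix (Fin n) (Fin n) ℝ) (t : ℝ) :
    NormedSpace.exp (t • adj A) = (NormedSpace.exp (t • Aᵀ)).map Complex.ofReal := by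
  rw [← exp_map_ofReal]
  congr 1
  ext i j
  simp [adj]

lemma re_map_ofReal_mulVec {m m' : Type*} [Fintype m] (M : Matrix m' m ℝ) (z : m → ℂ) (i : m') :
    ((M.map Complex.ofReal *ᵥ z) i).re = (M *ᵥ fun j => (z j).re) i := by
  simp [Matrix.mulVec, dotProduct]

/-- `e^{tA*}` is a real matrix, so real parts of complex states are genuine adjoint states with the
expected outputs. -/
lemma re_outputC (η : Fin q → Fin n → ℂ) (σ : Fin p) (t : ℝ) :
    (outputC A B η σ t).re = output A B (fun i a => (η i a).re) σ t := by
  simp only [outputC, output, exp_smul_adj, Complex.re_sum, dotProduct, Complex.re_ofReal_mul,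
    re_map_ofReal_mulVec]

lemma outputC_ofReal (η : Fin q → Fin n → ℝ) (σ : Fin p) (t : ℝ) :
    outputC A B (fun i a => (η i a : ℂ)) σ t = (output A B η σ t : ℂ) := by
  simp only [outputC, output, exp_smul_adj, dotProduct, Complex.ofReal_sum, Complex.ofReal_mul,
    Matrix.mulVec, Matrix.map_apply]

lemma output_add_smul (η θ : Fin q → Fin n → ℝ) (c : ℝ) (σ : Fin p) (t : ℝ) :
    output A B (η + c • θ) σ t = output A B η σ t + c * output A B θ σ t := by
  simp only [output, Pi.add_apply, Pi.smul_apply, Matrix.mulVec_add, Matrix.mulVec_smul,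
    dotProduct_add, dotProduct_smul, Finset.sum_add_distrib, Finset.mul_sum, smul_eq_mul]

/-- Moving the initial state along the adjoint flow shifts the output in time; this turns eventual
nonnegativity into nonnegativity on `[0, ∞)`. -/
lemma output_exp (η : Fin q → Fin n → ℝ) (σ : Fin p) (s t : ℝ) :
    output A B (fun i => NormedSpace.exp (s • Aᵀ) *ᵥ η i) σ t = output A B η σ (t + s) := by
  simp only [output, Matrix.mulVec_mulVec, ← exp_add_smul]

lemma continuous_output (η : Fin q → Fin n → ℝ) (σ : Fin p) : Continuous (output A B η σ) := by
  refine continuous_finsetSum _ fun i _ => ?_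
  exact continuous_const.dotProduct ((continuous_exp_smul Aᵀ).matrix_mulVec continuous_const)

lemma dotProduct_prod {ι m : Type*} [Fintype ι] [Fintype m] (w w' : ι × m → ℝ) :
    w ⬝ᵥ w' = ∑ i, (fun a => w (i, a)) ⬝ᵥ fun a => w' (i, a) :=
  Fintype.sum_prod_type _

lemma pow_mulVec_dotProduct_exp_mulVec {m : Type*} [Fintype m] [DecidableEq m]
    (M : Matrix m m ℝ) {K : ℕ} (hK : ∀ r, K ≤ r → M ^ r = 0) (b v : m → ℝ) (t : ℝ) (r : ℕ) :
    (M ^ r *ᵥ b) ⬝ᵥ (NormedSpace.exp (t • Mᵀ) *ᵥ v) =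
      ∑ s ∈ Finset.range K, t ^ s / (s.factorial : ℝ) * ((M ^ (r + s) *ᵥ b) ⬝ᵥ v) := by
  rw [exp_smul_mulVec_of_pow_mulVec_eq_zero Mᵀ v K, dotProduct_sum]
  · refine Finset.sum_congr rfl fun s _ => ?_
    rw [dotProduct_smul, smul_eq_mul, add_comm, pow_add, ← Matrix.mulVec_mulVec,
      Matrix.dotProduct_mulVec, ← Matrix.transpose_pow, Matrix.vecMul_transpose]
  · intro s hs
    rw [← Matrix.transpose_pow, hK s hs, Matrix.transpose_zero, Matrix.zero_mulVec]

namespace SpectralData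

variable (D : SpectralData A)

/-- The coefficients of the output at the initial state `(I ⊗ U_κ) ζ`. -/
def coeff (κ : Fin D.m) (ζ : Fin q → Fin (D.mult κ) → ℂ) (σ : Fin p) (r : ℕ) : ℂ :=
  ∑ i, (fun a => (B i σ a : ℂ)) ⬝ᵥ (D.U κ *ᵥ ((D.Lam κ)ᴴ ^ r *ᵥ ζ i))

lemma coeff_eq_zero (κ : Fin D.m) (ζ : Fin q → Fin (D.mult κ) → ℂ) (σ : Fin p) {r : ℕ}
    (hr : D.mult κ ≤ r) : D.coeff B κ ζ σ r = 0 := by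
  simp [coeff, D.Lam_conjTranspose_pow_eq_zero κ hr]

lemma outputC_U (κ : Fin D.m) (ζ : Fin q → Fin (D.mult κ) → ℂ) (σ : Fin p) (t : ℝ) :
    outputC A B (fun i => D.U κ *ᵥ ζ i) σ t = ∑ r ∈ Finset.range n,
      D.coeff B κ ζ σ r * ((t : ℂ) ^ r / (r.factorial : ℂ) * Complex.exp (D.μ κ * t)) := by
  simp only [outputC, exp_mulVec_U, dotProduct_sum, dotProduct_smul, coeff, Finset.sum_mul,
    smul_eq_mul]
  rw [Finset.sum_comm]
  exact Finset.sum_congr rfl fun r _ => Finset.sum_congr rfl fun i _ => mul_comm _ _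

lemma outputC_sum (ζ : ∀ κ, Fin q → Fin (D.mult κ) → ℂ) (σ : Fin p) (t : ℝ) :
    outputC A B (fun i => ∑ κ, D.U κ *ᵥ ζ κ i) σ t =
      ∑ κ, outputC A B (fun i => D.U κ *ᵥ ζ κ i) σ t := by
  simp only [outputC, Matrix.mulVec_sum, dotProduct_sum]
  exact Finset.sum_comm

/-- The link to connectivity: the coefficients are the Hermitian pairings of `ζ` with the columns of
`inc Q^{[κ]}`. -/
lemma coeff_eq_sum_star (κ : Fin D.m) (ζ : Fin q → Fin (D.mult κ) → ℂ) (σ : Fin p) (r : ℕ) :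
    D.coeff B κ ζ σ r = ∑ i, star (D.Lam κ ^ r *ᵥ D.Bk B κ i σ) ⬝ᵥ ζ i := by
  refine Finset.sum_congr rfl fun i _ => ?_
  rw [Matrix.star_mulVec, Bk, Matrix.star_mulVec, ← Matrix.dotProduct_mulVec,
    Matrix.conjTranspose_conjTranspose, ← Matrix.dotProduct_mulVec, Matrix.conjTranspose_pow]
  congr 1
  ext a
  simp

lemma coeff_smul (κ : Fin D.m) (c : ℂ) (ζ : Fin q → Fin (D.mult κ) → ℂ) (σ : Fin p) (r : ℕ) :
    D.coeff B κ (c • ζ) σ r = c * D.coeff B κ ζ σ r := by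
  simp [coeff, Matrix.mulVec_smul, Finset.mul_sum]

/-! #### Real eigenvalues -/

lemma mulVec_im_eq_zero {m m' : Type*} [Fintype m] {M : Matrix m' m ℂ} {v : m → ℂ}
    (hM : ∀ i j, (M i j).im = 0) (hv : ∀ j, (v j).im = 0) (i : m') : ((M *ᵥ v) i).im = 0 := by
  simp [Matrix.mulVec, dotProduct, Complex.im_sum, hM, hv]

lemma U_eq_map_re {κ : Fin D.m} (hκ : (D.μ κ).im = 0) :
    D.U κ = ((D.U κ).map Complex.re).map Complex.ofReal := by
  ext a b
  exact Complex.ext rfl (D.U_real κ hκ a b)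

/-- Conjugating `A* U_κ = U_κ A_κ*` fixes `A*` and `U_κ`, so injectivity of `U_κ` forces `A_κ` to be
real. -/
lemma Lam_eq_map_re {κ : Fin D.m} (hκ : (D.μ κ).im = 0) :
    D.Lam κ = ((D.Lam κ).map Complex.re).map Complex.ofReal := by
  have h1 : D.U κ * (D.Ared κ)ᴴ = D.U κ * ((D.Ared κ)ᴴ).map (starRingEnd ℂ) := by
    have hU : (D.U κ).map (starRingEnd ℂ) = D.U κ := by
      ext a b
      exact Complex.conj_eq_iff_im.2 (D.U_real κ hκ a b)
    have hA : (adj A).map (starRingEnd ℂ) = adj A := by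
      ext a b; simp [adj]
    have := congrArg (fun X : Matrix _ _ ℂ => X.map (starRingEnd ℂ)) (D.Ared_spec κ)
    simp only [Matrix.map_mul, hU, hA] at this
    rw [← D.Ared_spec, this]
  have h2 : (D.Ared κ)ᴴ = ((D.Ared κ)ᴴ).map (starRingEnd ℂ) := by
    refine Matrix.ext_of_mulVec_single fun j => D.U_mulVec_injective κ ?_
    rw [Matrix.mulVec_mulVec, Matrix.mulVec_mulVec, ← h1]
  ext a b
  have h3 : (D.Ared κ a b).im = 0 := by
    have := congrFun (congrFun h2 b) a
    simp only [Matrix.conjTranspose_apply, Matrix.map_apply, RCLike.star_def,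
      Complex.conj_conj] at this
    exact Complex.conj_eq_iff_im.1 this
  refine Complex.ext rfl ?_
  simp [Lam, h3, hκ, Matrix.one_apply, apply_ite]

lemma Lam_pow_eq_map {κ : Fin D.m} (hκ : (D.μ κ).im = 0) (r : ℕ) :
    D.Lam κ ^ r = (((D.Lam κ).map Complex.re) ^ r).map Complex.ofReal := by
  conv_lhs => rw [D.Lam_eq_map_re hκ]
  exact (map_pow (Complex.ofRealHom.mapMatrix) _ _).symm

lemma Lam_re_pow_eq_zero {κ : Fin D.m} (hκ : (D.μ κ).im = 0) {r : ℕ} (hr : D.mult κ ≤ r) :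
    ((D.Lam κ).map Complex.re) ^ r = 0 := by
  have := D.Lam_pow_eq_map hκ r
  rw [D.Lam_pow_eq_zero κ hr] at this
  ext i j
  simpa using (congrFun (congrFun this i) j).symm

lemma Bk_im {κ : Fin D.m} (hκ : (D.μ κ).im = 0) (i : Fin q) (σ : Fin p) (a) :
    (D.Bk B κ i σ a).im = 0 :=
  mulVec_im_eq_zero (fun i j => by simp [D.U_real κ hκ]) (fun j => by simp) a

lemma Lam_pow_mulVec_Bk {κ : Fin D.m} (hκ : (D.μ κ).im = 0) (r : ℕ) (i : Fin q) (σ : Fin p) (a) :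
    (D.Lam κ ^ r *ᵥ D.Bk B κ i σ) a = (D.LamB B κ r σ (i, a) : ℂ) := by
  refine Complex.ext rfl ?_
  rw [Complex.ofReal_im]
  refine mulVec_im_eq_zero (fun i j => ?_) (D.Bk_im B hκ i σ) a
  rw [D.Lam_pow_eq_map hκ]
  simp

lemma coeff_eq_sum_LamB {κ : Fin D.m} (hκ : (D.μ κ).im = 0) (ζ : Fin q → Fin (D.mult κ) → ℂ)
    (σ : Fin p) (r : ℕ) :
    D.coeff B κ ζ σ r = ∑ i, ∑ a, (D.LamB B κ r σ (i, a) : ℂ) * ζ i a := by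
  rw [coeff_eq_sum_star]
  refine Finset.sum_congr rfl fun i _ => Finset.sum_congr rfl fun a _ => ?_
  rw [Pi.star_apply, D.Lam_pow_mulVec_Bk B hκ, RCLike.star_def, Complex.conj_ofReal]

lemma re_coeff {κ : Fin D.m} (hκ : (D.μ κ).im = 0) (ζ : Fin q → Fin (D.mult κ) → ℂ)
    (σ : Fin p) (r : ℕ) :
    (D.coeff B κ ζ σ r).re = D.LamB B κ r σ ⬝ᵥ fun ia => (ζ ia.1 ia.2).re := by
  rw [D.coeff_eq_sum_LamB B hκ, dotProduct, Fintype.sum_prod_type]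
  simp

lemma coeff_ofReal {κ : Fin D.m} (hκ : (D.μ κ).im = 0) (ζ : Fin q × Fin (D.mult κ) → ℝ)
    (σ : Fin p) (r : ℕ) :
    D.coeff B κ (fun i a => (ζ (i, a) : ℂ)) σ r = (D.LamB B κ r σ ⬝ᵥ ζ : ℝ) := by
  rw [D.coeff_eq_sum_LamB B hκ, dotProduct, Fintype.sum_prod_type]
  simp

/-- The action of `e^{tΛ*}` on the blocks of a vector. -/
def shift (κ : Fin D.m) (t : ℝ) (v : Fin q × Fin (D.mult κ) → ℝ) : Fin q × Fin (D.mult κ) → ℝ :=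
  fun ia => (NormedSpace.exp (t • ((D.Lam κ).map Complex.re)ᵀ) *ᵥ fun a => v (ia.1, a)) ia.2

lemma LamB_eq {κ : Fin D.m} (hκ : (D.μ κ).im = 0) (r : ℕ) (i : Fin q) (σ : Fin p) :
    (fun a => D.LamB B κ r σ (i, a)) =
      ((D.Lam κ).map Complex.re) ^ r *ᵥ fun a => (D.Bk B κ i σ a).re := by
  ext a
  rw [LamB, D.Lam_pow_eq_map hκ, re_map_ofReal_mulVec]

/-- Nilpotency turns `e^{tΛ*}` into a polynomial in `t`; transposed onto the columns, its terms are
the pairings with the later columns `r + s`. -/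
lemma LamB_dotProduct_shift {κ : Fin D.m} (hκ : (D.μ κ).im = 0) (t : ℝ)
    (v : Fin q × Fin (D.mult κ) → ℝ) (σ : Fin p) (r : ℕ) :
    D.LamB B κ r σ ⬝ᵥ D.shift κ t v =
      ∑ s ∈ Finset.range n, t ^ s / (s.factorial : ℝ) * (D.LamB B κ (r + s) σ ⬝ᵥ v) := by
  have h1 := fun i => pow_mulVec_dotProduct_exp_mulVec ((D.Lam κ).map Complex.re)
    (fun r hr => D.Lam_re_pow_eq_zero hκ ((D.mult_le κ).trans hr))
    (fun a => (D.Bk B κ i σ a).re) (fun a => v (i, a)) t r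
  simp only [← D.LamB_eq B hκ] at h1
  simp only [dotProduct_prod, Finset.mul_sum]
  rw [Finset.sum_comm]
  exact Finset.sum_congr rfl fun i _ => h1 i

lemma shift_neg_shift (κ : Fin D.m) (t : ℝ) (v : Fin q × Fin (D.mult κ) → ℝ) :
    D.shift κ (-t) (D.shift κ t v) = v := by
  ext ⟨i, a⟩
  change (NormedSpace.exp ((-t) • _) *ᵥ (NormedSpace.exp (t • _) *ᵥ fun a => v (i, a))) a = _
  rw [Matrix.mulVec_mulVec, exp_neg_smul_mul_exp_smul, Matrix.one_mulVec]

end SpectralData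

end RelArray

namespace RelArray

open Filter Topology

variable {q p n : ℕ} {A : Matrix (Fin n) (Fin n) ℝ} (B : Fin q → Fin p → Fin n → ℝ)

/-! ### Connectivity makes the dual cone trivial on the pair -/

lemma pairMatrix_mulVec {𝕜 : Type} [RCLike 𝕜] (k l : Fin q) (d : ℕ) (w : Fin d → 𝕜)
    (i : Fin q) (a : Fin d) : (pairMatrix 𝕜 k l d *ᵥ w) (i, a) =
      (Pi.single k (1 : 𝕜) - Pi.single l (1 : 𝕜) : Fin q → 𝕜) i * w a := by
  simp [pairMatrix, Matrix.mulVec, dotProduct, Matrix.one_apply]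

lemma sum_pairMatrix_mulVec_mul {𝕜 : Type} [RCLike 𝕜] (k l : Fin q) (d : ℕ) (w : Fin d → 𝕜)
    (v : Fin q × Fin d → 𝕜) : (pairMatrix 𝕜 k l d *ᵥ w) ⬝ᵥ v = ∑ a, w a * (v (k, a) - v (l, a)) := by
  rw [dotProduct, Fintype.sum_prod_type_right]
  refine Finset.sum_congr rfl fun a _ => ?_
  simp only [pairMatrix_mulVec, Pi.sub_apply, sub_mul, Finset.sum_sub_distrib, mul_sub]
  congr 1 <;>
  · simp [Pi.single_apply]

namespace SpectralData

variable (D : SpectralData A)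

lemma inc_Q_col (κ : Fin D.m) (I : Finset (Fin p)) (j : I × Fin (D.mult κ)) :
    ((inc (D.Q B κ) I).map Complex.re).col j = D.LamB B κ j.2 j.1 := by
  ext ia
  simp only [Matrix.col_apply, Matrix.map_apply, inc, Matrix.of_apply, Q, LamB]

lemma dotProduct_nonneg_of_mem_cone_inc_Q {κ : Fin D.m} {I : Finset (Fin p)}
    {v w : Fin q × Fin (D.mult κ) → ℝ}
    (hv : ∀ σ ∈ I, ∀ r : Fin (D.mult κ), 0 ≤ D.LamB B κ r σ ⬝ᵥ v)
    (hw : w ∈ cone ((inc (D.Q B κ) I).map Complex.re)) : 0 ≤ w ⬝ᵥ v := by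
  refine dotProduct_nonneg_of_mem_cone (fun j => ?_) hw
  rw [inc_Q_col]
  exact hv j.1 j.1.2 j.2

/-- A vector of the dual cone is nonnegative on both `(e_k - e_l) ⊗ e_a` and its negative, hence
vanishes there. -/
lemma eq_of_stronglyPairConnected {κ : Fin D.m} {k l : Fin q}
    (h : StronglyPairConnected (D.incQ B κ) k l) {v : Fin q × Fin (D.mult κ) → ℝ}
    (hv : ∀ σ ∈ D.index B κ, ∀ r : Fin (D.mult κ), 0 ≤ D.LamB B κ r σ ⬝ᵥ v) (a : Fin (D.mult κ)) :
    v (k, a) = v (l, a) := by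
  have h1 : ∀ w, 0 ≤ (pairMatrix ℝ k l (D.mult κ) *ᵥ w) ⬝ᵥ v := fun w =>
    D.dotProduct_nonneg_of_mem_cone_inc_Q B hv (h.2 ⟨w, rfl⟩)
  simp only [sum_pairMatrix_mulVec_mul] at h1
  have h2 := h1 (Pi.single a 1)
  have h3 := h1 (Pi.single a (-1))
  simp [Pi.single_apply] at h2 h3
  exact le_antisymm h3 h2

/-- Vanishing coefficients make `ζ` orthogonal to the range of `inc Q^{[κ]}`, hence to every `(e_k -
e_l) ⊗ e_a`. -/
lemma eq_of_pairConnected {κ : Fin D.m} {k l : Fin q}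
    (h : PairConnected (D.incQ B κ) k l) {ζ : Fin q → Fin (D.mult κ) → ℂ}
    (hζ : ∀ σ ∈ D.index B κ, ∀ r : Fin (D.mult κ), D.coeff B κ ζ σ r = 0) : ζ k = ζ l := by
  have h1 : ∀ α, star (D.incQ B κ *ᵥ α) ⬝ᵥ (fun ia => ζ ia.1 ia.2) = 0 := by
    intro α
    rw [Matrix.star_mulVec, ← Matrix.dotProduct_mulVec]
    have : (D.incQ B κ)ᴴ *ᵥ (fun ia => ζ ia.1 ia.2) = 0 := by
      ext ⟨σ, r⟩
      have := hζ σ σ.2 r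
      rw [coeff_eq_sum_star] at this
      simp only [Matrix.mulVec, dotProduct, Fintype.sum_prod_type]
      exact this
    rw [this, dotProduct_zero]
  ext a
  obtain ⟨α, hα⟩ := h ⟨Pi.single a 1, rfl⟩
  have h2 := h1 α
  rw [hα] at h2
  have h3 : star (pairMatrix ℂ k l (D.mult κ) *ᵥ Pi.single a 1) =
      pairMatrix ℂ k l (D.mult κ) *ᵥ Pi.single a 1 := by
    ext ⟨i, b⟩
    rw [Pi.star_apply, pairMatrix_mulVec]
    simp only [Pi.sub_apply, Pi.single_apply]
    split_ifs <;> simp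
  rw [h3, sum_pairMatrix_mulVec_mul] at h2
  simpa [Pi.single_apply, sub_eq_zero] using h2

/-- A functional that is nonnegative on the cone vanishes on each subspace inside it. Its kernel
therefore contains their supremum, and it need not be shown that the supremum lies in the cone. -/
lemma lineality_dotProduct_eq_zero {κ : Fin D.m} {I : Finset (Fin p)}
    {v : Fin q × Fin (D.mult κ) → ℝ}
    (hv : ∀ σ ∈ I, ∀ r : Fin (D.mult κ), 0 ≤ D.LamB B κ r σ ⬝ᵥ v)
    {w : Fin q × Fin (D.mult κ) → ℝ} (hw : w ∈ D.lineality B κ I) : w ⬝ᵥ v = 0 := by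
  let φ : (Fin q × Fin (D.mult κ) → ℝ) →ₗ[ℝ] ℝ :=
    { toFun := fun w => w ⬝ᵥ v
      map_add' := fun x y => add_dotProduct x y v
      map_smul' := fun c x => smul_dotProduct c x v }
  have hle : D.lineality B κ I ≤ LinearMap.ker φ := by
    refine sSup_le fun S hS x hx => ?_
    have h0 : ∀ y ∈ S, 0 ≤ y ⬝ᵥ v := fun y hy =>
      D.dotProduct_nonneg_of_mem_cone_inc_Q B hv (hS hy)
    have h1 := h0 x hx
    have h2 := h0 (-x) (S.neg_mem hx)
    rw [neg_dotProduct] at h2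
    exact le_antisymm (neg_nonneg.1 h2) h1
  exact hle hw

lemma indexSeq_succ_eq_sdiff {j : ℕ} (hj : j < D.m) :
    D.indexSeq B (j + 1) = D.indexSeq B j \ D.removed B ⟨j, hj⟩ (D.indexSeq B j) := by
  rw [indexSeq, dif_pos hj]

lemma indexSeq_succ_subset (j : ℕ) : D.indexSeq B (j + 1) ⊆ D.indexSeq B j := by
  rw [indexSeq]
  split_ifs
  · exact Finset.sdiff_subset
  · exact subset_rfl

lemma indexSeq_anti {i j : ℕ} (h : i ≤ j) : D.indexSeq B j ⊆ D.indexSeq B i :=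
  antitone_nat_of_succ_le (f := D.indexSeq B) (fun j => D.indexSeq_succ_subset B j) h

lemma LamB_mem_lineality {κ : Fin D.m} (hκ : (D.μ κ).im = 0) {σ : Fin p}
    (hσ : σ ∈ D.indexSeq B (κ + 1)) (r : ℕ) : D.LamB B κ r σ ∈ D.lineality B κ (D.index B κ) := by
  classical
  rcases lt_or_ge r (D.mult κ) with hr | hr
  · rw [D.indexSeq_succ_eq_sdiff B κ.2, Finset.mem_sdiff] at hσ
    by_contra hcon
    refine hσ.2 ?_
    rw [removed, if_pos hκ, Finset.mem_filter]
    exact ⟨hσ.1, ⟨r, hr⟩, hcon⟩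
  · have : D.LamB B κ r σ = 0 := by
      ext ia
      simp [LamB, D.Lam_pow_eq_zero κ hr]
    rw [this]
    exact Submodule.zero_mem _

/-- One step of the elimination: if all contributions of the eigenvalues before `κ` to the
nonnegative outputs in `I_κ` vanish, then the initial state agrees on the pair in the generalized
eigenspace of `κ`, and the contributions of `κ` to the outputs in `I_{κ+1}` vanish. -/
lemma coeff_elimination_step {η : Fin q → Fin n → ℝ}
    (hη : ∀ σ t, 0 ≤ t → 0 ≤ output A B η σ t) {ζ : ∀ κ, Fin q → Fin (D.mult κ) → ℂ}
    (hζ : ∀ i, (fun a => (η i a : ℂ)) = ∑ κ, D.U κ *ᵥ ζ κ i) {k l : Fin q} (κ : Fin D.m)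
    (hprev : ∀ σ ∈ D.index B κ, ∀ ν < κ, ∀ r, D.coeff B ν (ζ ν) σ r = 0)
    (ha : (D.μ κ).im = 0 → StronglyPairConnected (D.incQ B κ) k l)
    (hb : (D.μ κ).im ≠ 0 → PairConnected (D.incQ B κ) k l) :
    (∀ σ ∈ D.indexSeq B (κ + 1), ∀ r, D.coeff B κ (ζ κ) σ r = 0) ∧
      ∀ a, ((D.U κ *ᵥ ζ κ k) a).re = ((D.U κ *ᵥ ζ κ l) a).re := by
  have hN : ∀ σ ν r, n ≤ r → D.coeff B ν (ζ ν) σ r = 0 := fun σ ν r hr =>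
    D.coeff_eq_zero B ν _ σ ((D.mult_le ν).trans hr)
  have hf : ∀ σ t, 0 ≤ t → (output A B η σ t : ℂ) = ∑ ν, ∑ r ∈ Finset.range n,
      D.coeff B ν (ζ ν) σ r * ((t : ℂ) ^ r / (r.factorial : ℂ) * Complex.exp (D.μ ν * t)) := by
    intro σ t _
    rw [← outputC_ofReal, show (fun i a => (η i a : ℂ)) = fun i => ∑ κ, D.U κ *ᵥ ζ κ i from
      funext hζ, outputC_sum]
    exact Finset.sum_congr rfl fun ν _ => D.outputC_U B ν _ σ t
  have hα : ∀ σ ∈ D.index B κ, ∀ ν, (D.μ κ).re < (D.μ ν).re →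
      ∀ r, D.coeff B ν (ζ ν) σ r = 0 := by
    intro σ hσ ν hν
    refine hprev σ hσ ν (not_le.1 fun hle => ?_)
    exact absurd (D.μ_antitone κ ν hle) (not_le.2 hν)
  have hA1 := fun σ hσ => coeff_eq_zero_of_nonneg D.μ n (fun ν r => D.coeff B ν (ζ ν) σ r)
    (hN σ) _ (hη σ) (hf σ) (D.μ κ).re (hα σ hσ) D.μ_injective
  have hA2 := fun σ hσ => leading_coeff_nonneg_of_nonneg D.μ n
    (fun ν r => D.coeff B ν (ζ ν) σ r)
    (hN σ) _ (hη σ) (hf σ) (D.μ κ).re (hα σ hσ) D.μ_injective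
  by_cases hκ : (D.μ κ).im = 0
  · have hμ : ((D.μ κ).re : ℂ) = D.μ κ := Complex.ext rfl (by simp [hκ])
    have hsum : ∀ σ r, (∑ ν, if D.μ ν = ((D.μ κ).re : ℂ) then D.coeff B ν (ζ ν) σ r else 0) =
        D.coeff B κ (ζ κ) σ r := by
      intro σ r
      simp [hμ, D.μ_injective.eq_iff]
    simp only [hsum, D.re_coeff B hκ] at hA1 hA2
    set v : Fin q × Fin (D.mult κ) → ℝ := fun ia => (ζ κ ia.1 ia.2).re with hv
    have hzero : ∀ σ r, n ≤ r → D.LamB B κ r σ ⬝ᵥ v = 0 := fun σ r hr => by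
      rw [hv, ← D.re_coeff B hκ, hN σ κ r hr, Complex.zero_re]
    -- Only the leading pairings of `v` are known to be nonnegative. After a long enough shift they
    -- decide the signs of all pairings, and the shifted vector lies in the dual cone.
    have hev : ∀ᶠ t : ℝ in atTop, ∀ σ : D.index B κ, ∀ r : Fin (D.mult κ),
        0 ≤ D.LamB B κ r σ ⬝ᵥ D.shift κ t v := by
      refine eventually_all.2 fun σ => eventually_all.2 fun r => ?_
      simp only [D.LamB_dotProduct_shift B hκ]
      refine eventually_sum_pow_nonneg _ n (fun s hs => hzero _ _ (by omega)) fun d hd => ?_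
      refine hA2 σ σ.2 (r + d) fun s hs => ?_
      obtain ⟨s', rfl⟩ : ∃ s', s = r + s' := ⟨s - r, by omega⟩
      exact hd s' (by omega)
    obtain ⟨t, ht⟩ := hev.exists
    have ht' : ∀ σ ∈ D.index B κ, ∀ r : Fin (D.mult κ),
        0 ≤ D.LamB B κ r σ ⬝ᵥ D.shift κ t v := fun σ hσ r => ht ⟨σ, hσ⟩ r
    constructor
    · intro σ hσ r
      have h0 : ∀ r, D.LamB B κ r σ ⬝ᵥ D.shift κ t v = 0 := fun r =>
        D.lineality_dotProduct_eq_zero B ht' (D.LamB_mem_lineality B hκ hσ r)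
      -- The pairings control only the real parts of the coefficients; domination then kills the
      -- coefficients themselves.
      refine hA1 σ (D.indexSeq_succ_subset B κ hσ) 0 (fun r _ => ?_) κ rfl r (Nat.zero_le _)
      rw [← D.shift_neg_shift κ t v, D.LamB_dotProduct_shift B hκ]
      simp [h0]
    · have h1 : ∀ a, v (k, a) = v (l, a) := by
        have h2 := D.eq_of_stronglyPairConnected B (ha hκ) ht'
        have h3 : (fun a => v (k, a)) = fun a => v (l, a) :=
          exp_smul_mulVec_injective _ t (funext h2)
        exact congrFun h3
      intro a
      rw [D.U_eq_map_re hκ, re_map_ofReal_mulVec, re_map_ofReal_mulVec]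
      congr 2
      exact funext h1
  -- The real exponent `Re μ_κ` is either no eigenvalue or one enumerated before `κ`, already
  -- eliminated. Domination by this zero coefficient kills every coefficient at `μ_κ`.
  · have hsum : ∀ σ ∈ D.index B κ, ∀ r,
        (∑ ν, if D.μ ν = ((D.μ κ).re : ℂ) then D.coeff B ν (ζ ν) σ r else 0) = 0 := by
      intro σ hσ r
      refine Finset.sum_eq_zero fun ν _ => ?_
      split_ifs with h
      · refine hprev σ hσ ν (D.μ_real_first κ ν ?_ h.symm) r
        rintro rfl
        exact hκ (by rw [h, Complex.ofReal_im])
      · rfl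
    have hz : ∀ σ ∈ D.index B κ, ∀ r, D.coeff B κ (ζ κ) σ r = 0 := fun σ hσ r =>
      hA1 σ hσ 0 (fun r _ => by rw [hsum σ hσ r, Complex.zero_re]) κ rfl r (Nat.zero_le _)
    refine ⟨fun σ hσ r => hz σ (D.indexSeq_succ_subset B κ hσ) r, fun a => ?_⟩
    rw [D.eq_of_pairConnected B (hb hκ) fun σ hσ r => hz σ hσ r]

/-- If the connectivity conditions hold, then every initial state of the adjoint system with
nonnegative outputs agrees on the pair. -/
theorem eq_of_output_nonneg {k l : Fin q}
    (ha : ∀ κ, (D.μ κ).im = 0 → StronglyPairConnected (D.incQ B κ) k l)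
    (hb : ∀ κ, (D.μ κ).im ≠ 0 → PairConnected (D.incQ B κ) k l) {η : Fin q → Fin n → ℝ}
    (hη : ∀ σ t, 0 ≤ t → 0 ≤ output A B η σ t) : η k = η l := by
  choose ζ' hζ' using fun i => D.exists_eq_sum_U_mulVec (fun a => (η i a : ℂ))
  have hprev : ∀ j : ℕ, ∀ σ ∈ D.indexSeq B j, ∀ ν : Fin D.m, (ν : ℕ) < j →
      ∀ r, D.coeff B ν (fun i => ζ' i ν) σ r = 0 := by
    intro j
    induction j with
    | zero => exact fun σ _ ν hν => absurd hν (Nat.not_lt_zero _)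
    | succ j ih =>
      intro σ hσ ν hν
      rcases (Nat.lt_succ_iff.1 hν).eq_or_lt with h | h
      · subst h
        exact (D.coeff_elimination_step B hη (ζ := fun κ i => ζ' i κ) hζ' ν
          (fun σ hσ ν' hν' => ih σ hσ ν' hν') (ha ν) (hb ν)).1 σ hσ
      · exact ih σ (D.indexSeq_succ_subset B j hσ) ν h
  have hU := fun κ => (D.coeff_elimination_step B hη (ζ := fun κ i => ζ' i κ) hζ' κ
    (fun σ hσ ν hν => hprev κ σ hσ ν hν) (ha κ) (hb κ)).2
  ext a
  have h1 : ∀ i, η i a = ∑ κ, ((D.U κ *ᵥ ζ' i κ) a).re := fun i => by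
    have := congrArg Complex.re (congrFun (hζ' i) a)
    simpa using this
  rw [h1, h1]
  exact Finset.sum_congr rfl fun κ _ => hU κ a

end SpectralData

end RelArray

namespace RelArray

open Filter Topology

variable {q p n : ℕ} {A : Matrix (Fin n) (Fin n) ℝ} (B : Fin q → Fin p → Fin n → ℝ)

/-! ### Construction of initial states with nonnegative outputs -/

namespace SpectralData

variable (D : SpectralData A)

/-- If the negative of a generator also lay in the cone, the whole line would, and the generator
would belong to the lineality space. So Farkas separates the negative. -/
lemma exists_nonneg_dotProduct_pos (κ : Fin D.m) {I : Finset (Fin p)} {σ : Fin p} (hσ : σ ∈ I)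
    (r : Fin (D.mult κ)) (hr : D.LamB B κ r σ ∉ D.lineality B κ I) :
    ∃ v : Fin q × Fin (D.mult κ) → ℝ,
      (∀ σ ∈ I, ∀ r : Fin (D.mult κ), 0 ≤ D.LamB B κ r σ ⬝ᵥ v) ∧ 0 < D.LamB B κ r σ ⬝ᵥ v := by
  classical
  set g := D.LamB B κ r σ with hg
  set G := (inc (D.Q B κ) I).map Complex.re with hG
  have hmem : g ∈ pointedCone G :=
    ⟨Pi.single (⟨σ, hσ⟩, r) 1, fun j => by
      by_cases h : j = (⟨σ, hσ⟩, r)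
      · subst h; simp
      · simp [h], by
      rw [Matrix.mulVec_single_one, hG, inc_Q_col]⟩
  have hneg : -g ∉ cone G := by
    intro hcon
    refine hr ((le_sSup (a := Submodule.span ℝ {g}) ?_) (Submodule.mem_span_singleton_self g))
    intro x hx
    obtain ⟨c, rfl⟩ := Submodule.mem_span_singleton.1 hx
    rcases le_total 0 c with hc | hc
    · exact (pointedCone G).smul_mem hc hmem
    · have := (pointedCone G).smul_mem (neg_nonneg.2 hc) (show -g ∈ pointedCone G from hcon)
      rwa [smul_neg, neg_smul, neg_neg] at this
  obtain ⟨v, hv, hv'⟩ := exists_dotProduct_neg_of_notMem_cone G hneg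
  refine ⟨v, fun σ hσ r => ?_, by rwa [neg_dotProduct, neg_lt_zero] at hv'⟩
  have := hv (⟨σ, hσ⟩, r)
  rwa [hG, inc_Q_col] at this

/-- A vector in the relative interior of the dual cone. -/
lemma exists_dotProduct_pos_of_notMem_lineality (κ : Fin D.m) (I : Finset (Fin p)) :
    ∃ v : Fin q × Fin (D.mult κ) → ℝ,
      (∀ σ ∈ I, ∀ r : Fin (D.mult κ), 0 ≤ D.LamB B κ r σ ⬝ᵥ v) ∧
      ∀ σ ∈ I, ∀ r : Fin (D.mult κ), D.LamB B κ r σ ∉ D.lineality B κ I →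
        0 < D.LamB B κ r σ ⬝ᵥ v := by
  classical
  have h : ∀ j : I × Fin (D.mult κ), ∃ v : Fin q × Fin (D.mult κ) → ℝ,
      (∀ σ ∈ I, ∀ r : Fin (D.mult κ), 0 ≤ D.LamB B κ r σ ⬝ᵥ v) ∧
      (D.LamB B κ j.2 j.1 ∉ D.lineality B κ I → 0 < D.LamB B κ j.2 j.1 ⬝ᵥ v) := by
    intro j
    by_cases hj : D.LamB B κ j.2 j.1 ∈ D.lineality B κ I
    · exact ⟨0, fun _ _ _ => by simp, fun h => absurd hj h⟩
    · obtain ⟨v, hv, hv'⟩ := D.exists_nonneg_dotProduct_pos B κ j.1.2 j.2 hj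
      exact ⟨v, hv, fun _ => hv'⟩
  choose v hv hv' using h
  refine ⟨∑ j, v j, fun σ hσ r => ?_, fun σ hσ r hr => ?_⟩
  · rw [dotProduct_sum]
    exact Finset.sum_nonneg fun j _ => hv j σ hσ r
  · rw [dotProduct_sum]
    exact Finset.sum_pos' (fun j _ => hv j σ hσ r)
      ⟨(⟨σ, hσ⟩, r), Finset.mem_univ _, hv' (⟨σ, hσ⟩, r) hr⟩

/-! ### Growth rates of the adjoint outputs -/

lemma norm_outputC_term (κ : Fin D.m) (c : ℂ) (r : ℕ) (α : ℝ) {t : ℝ} (ht : 0 ≤ t) :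
    ‖((Real.exp (-α * t) : ℝ) : ℂ) *
      (c * ((t : ℂ) ^ r / (r.factorial : ℂ) * Complex.exp (D.μ κ * t)))‖ =
      ‖c‖ / r.factorial * (t ^ r * Real.exp (-(α - (D.μ κ).re) * t)) := by
  rw [norm_mul, norm_mul, norm_mul, Complex.norm_real, Complex.norm_exp, Real.norm_eq_abs,
    abs_of_pos (Real.exp_pos _), show -(α - (D.μ κ).re) * t = -α * t + (D.μ κ).re * t by ring,
    Real.exp_add]
  simp [abs_of_nonneg ht]
  ring

lemma tendsto_exp_mul_outputC (κ : Fin D.m) (ζ : Fin q → Fin (D.mult κ) → ℂ) (σ : Fin p) {α : ℝ}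
    (hα : (D.μ κ).re < α) : Tendsto (fun t : ℝ => Real.exp (-α * t) *
      (outputC A B (fun i => D.U κ *ᵥ ζ i) σ t).re) atTop (𝓝 0) := by
  have h1 : ∀ r ∈ Finset.range n, Tendsto (fun t : ℝ => ((Real.exp (-α * t) : ℝ) : ℂ) *
      (D.coeff B κ ζ σ r * ((t : ℂ) ^ r / (r.factorial : ℂ) * Complex.exp (D.μ κ * t))))
      atTop (𝓝 0) := by
    intro r _
    rw [tendsto_zero_iff_norm_tendsto_zero]
    have h2 := (tendsto_rpow_mul_exp_neg_mul_atTop_nhds_zero r (α - (D.μ κ).re)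
      (sub_pos.2 hα)).const_mul (‖D.coeff B κ ζ σ r‖ / r.factorial)
    rw [mul_zero] at h2
    refine h2.congr' ?_
    filter_upwards [eventually_ge_atTop 0] with t ht
    rw [D.norm_outputC_term κ _ r α ht, Real.rpow_natCast]
  have h3 := (Complex.continuous_re.tendsto _).comp (tendsto_finsetSum _ h1)
  simp only [Finset.sum_const_zero, Complex.zero_re] at h3
  refine h3.congr fun t => ?_
  rw [Function.comp_apply, ← Finset.mul_sum, Complex.re_ofReal_mul, D.outputC_U]

/-- On the critical line `Re μ_κ = α`, semisimplicity leaves no polynomial factors, so the rescaled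
output stays bounded. -/
lemma exists_eventually_abs_exp_mul_outputC_le (κ : Fin D.m) (ζ : Fin q → Fin (D.mult κ) → ℂ)
    (σ : Fin p) {α : ℝ} (hα : (D.μ κ).re < α ∨ (D.μ κ).re = α ∧ D.Lam κ = 0) :
    ∃ C : ℝ, 0 ≤ C ∧ ∀ᶠ t : ℝ in atTop,
      |Real.exp (-α * t) * (outputC A B (fun i => D.U κ *ᵥ ζ i) σ t).re| ≤ C := by
  rcases hα with hα | ⟨hα, hL⟩
  · refine ⟨1, zero_le_one, ?_⟩
    have := (D.tendsto_exp_mul_outputC B κ ζ σ hα).abs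
    rw [abs_zero] at this
    exact (this.eventually (gt_mem_nhds one_pos)).mono fun t ht => le_of_lt ht
  · refine ⟨∑ r ∈ Finset.range n, ‖D.coeff B κ ζ σ r‖,
      Finset.sum_nonneg fun _ _ => norm_nonneg _, ?_⟩
    filter_upwards [eventually_ge_atTop 0] with t ht
    rw [← Complex.re_ofReal_mul, D.outputC_U, Finset.mul_sum]
    refine (Complex.abs_re_le_norm _).trans ((norm_sum_le _ _).trans
      (Finset.sum_le_sum fun r _ => ?_))
    rw [D.norm_outputC_term κ _ r α ht, hα, sub_self]
    rcases Nat.eq_zero_or_pos r with rfl | hr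
    · simp
    · have : D.coeff B κ ζ σ r = 0 := by simp [coeff, hL, hr.ne']
      simp [this]

lemma re_outputC_of_im_eq_zero {κ : Fin D.m} (hκ : (D.μ κ).im = 0)
    (v : Fin q × Fin (D.mult κ) → ℝ) (σ : Fin p) (t : ℝ) :
    (outputC A B (fun i => D.U κ *ᵥ fun a => (v (i, a) : ℂ)) σ t).re =
      Real.exp ((D.μ κ).re * t) * ∑ r ∈ Finset.range n,
        t ^ r / (r.factorial : ℝ) * (D.LamB B κ r σ ⬝ᵥ v) := by
  have hμ : D.μ κ = ((D.μ κ).re : ℂ) := Complex.ext rfl (by simp [hκ])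
  rw [D.outputC_U B κ (fun i a => (v (i, a) : ℂ)) σ t, Finset.mul_sum, Complex.re_sum]
  refine Finset.sum_congr rfl fun r _ => ?_
  rw [D.coeff_ofReal B hκ, Complex.re_ofReal_mul, hμ, ← Complex.ofReal_mul, ← Complex.ofReal_exp,
    ← Complex.ofReal_natCast, ← Complex.ofReal_pow, ← Complex.ofReal_div, ← Complex.ofReal_mul,
    Complex.ofReal_re]
  simp only [Complex.ofReal_re]
  ring

lemma LamB_eq_zero (κ : Fin D.m) (σ : Fin p) {r : ℕ} (hr : D.mult κ ≤ r) :
    D.LamB B κ r σ = 0 := by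
  ext ia
  simp [LamB, D.Lam_pow_eq_zero κ hr]

lemma LamB_dotProduct_nonneg {κ : Fin D.m} {I : Finset (Fin p)}
    {v : Fin q × Fin (D.mult κ) → ℝ}
    (hv : ∀ σ ∈ I, ∀ r : Fin (D.mult κ), 0 ≤ D.LamB B κ r σ ⬝ᵥ v) {σ : Fin p} (hσ : σ ∈ I)
    (r : ℕ) : 0 ≤ D.LamB B κ r σ ⬝ᵥ v := by
  rcases lt_or_ge r (D.mult κ) with hr | hr
  · exact hv σ hσ ⟨r, hr⟩
  · rw [D.LamB_eq_zero B κ σ hr, zero_dotProduct]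

lemma index_subset_indexSeq_succ {ν κ : Fin D.m} (h : ν < κ) :
    D.index B κ ⊆ D.indexSeq B (ν + 1) :=
  D.indexSeq_anti B (i := ν + 1) (j := κ) h

/-- Look at the step where `σ` was discarded; only real eigenvalues discard indices. -/
lemma exists_removed {j : ℕ} {σ : Fin p} (hσ : σ ∉ D.indexSeq B j) :
    ∃ ν : Fin D.m, (ν : ℕ) < j ∧ (D.μ ν).im = 0 ∧ σ ∈ D.index B ν ∧
      ∃ r : Fin (D.mult ν), D.LamB B ν r σ ∉ D.lineality B ν (D.index B ν) := by
  classical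
  induction j with
  | zero => exact absurd (Finset.mem_univ σ) hσ
  | succ j ih =>
    by_cases h : σ ∈ D.indexSeq B j
    · by_cases hj : j < D.m
      · rw [D.indexSeq_succ_eq_sdiff B hj, Finset.mem_sdiff, not_and_not_right] at hσ
        have h2 := hσ h
        rw [removed] at h2
        split_ifs at h2 with him
        · exact ⟨⟨j, hj⟩, Nat.lt_succ_self j, him, h, (Finset.mem_filter.1 h2).2⟩
        · exact absurd h2 (Finset.notMem_empty σ)
      · rw [indexSeq, dif_neg hj] at hσ
        exact absurd h hσ
    · obtain ⟨ν, hν, h'⟩ := ih h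
      exact ⟨ν, hν.trans (Nat.lt_succ_self j), h'⟩

/-- If nonnegative outputs force agreement on the pair, then they do so in each generalized
eigenspace, for the outputs in `I_κ`. -/
theorem re_U_mulVec_eq_of_outputC_nonneg (h₁ : D.SemisimpleAssumption) {k l : Fin q}
    (hP : ∀ η : Fin q → Fin n → ℝ, (∀ σ t, 0 ≤ t → 0 ≤ output A B η σ t) → η k = η l)
    (κ : Fin D.m) (ζ : Fin q → Fin (D.mult κ) → ℂ)
    (hζ : ∀ σ ∈ D.index B κ, ∀ t, 0 ≤ t → 0 ≤ (outputC A B (fun i => D.U κ *ᵥ ζ i) σ t).re)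
    (a : Fin n) : ((D.U κ *ᵥ ζ k) a).re = ((D.U κ *ᵥ ζ l) a).re := by
  classical
  choose v hv hv' using fun ν => D.exists_dotProduct_pos_of_notMem_lineality B ν (D.index B ν)
  -- Background state: a relative-interior vector of the dual cone at each real eigenvalue before
  -- `κ`, and nothing elsewhere.
  let w : ∀ ν : Fin D.m, Fin q → Fin (D.mult ν) → ℂ := fun ν =>
    if (D.μ ν).im = 0 ∧ ν < κ then fun i a => (v ν (i, a) : ℂ) else 0
  let E : Fin D.m → Fin p → ℝ → ℝ := fun ν σ t => (outputC A B (fun i => D.U ν *ᵥ w ν i) σ t).re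
  have hE0 : ∀ ν σ t, ¬ ((D.μ ν).im = 0 ∧ ν < κ) → E ν σ t = 0 := by
    intro ν σ t h
    simp [E, w, h, outputC]
  have hE1 : ∀ ν, (D.μ ν).im = 0 → ν < κ → ∀ σ t, E ν σ t = Real.exp ((D.μ ν).re * t) *
      ∑ r ∈ Finset.range n, t ^ r / (r.factorial : ℝ) * (D.LamB B ν r σ ⬝ᵥ v ν) := by
    intro ν him hlt σ t
    rw [← D.re_outputC_of_im_eq_zero B him]
    simp only [E, w]
    rw [if_pos ⟨him, hlt⟩]
  -- Vectors of the dual cone are orthogonal to the lineality space, so the background at `ν` is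
  -- invisible to the outputs that survive step `ν`.
  have hE2 : ∀ (ν : Fin D.m) (σ : Fin p) (t : ℝ), σ ∈ D.indexSeq B (ν + 1) → E ν σ t = 0 := by
    intro ν σ t hσ
    by_cases h : (D.μ ν).im = 0 ∧ ν < κ
    · rw [hE1 ν h.1 h.2, Finset.sum_eq_zero, mul_zero]
      intro r _
      rw [D.lineality_dotProduct_eq_zero B (hv ν) (D.LamB_mem_lineality B h.1 hσ r), mul_zero]
    · exact hE0 ν σ t h
  let θ : Fin q → Fin n → ℝ := fun i a => ((∑ ν, D.U ν *ᵥ w ν i) a).re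
  have hθ : ∀ σ t, output A B θ σ t = ∑ ν, E ν σ t := by
    intro σ t
    rw [← re_outputC, D.outputC_sum, Complex.re_sum]
  let ψ : Fin q → Fin n → ℝ := fun i a => ((D.U κ *ᵥ ζ i) a).re
  have hψ : ∀ σ t, output A B ψ σ t = (outputC A B (fun i => D.U κ *ᵥ ζ i) σ t).re :=
    fun σ t => (re_outputC B _ σ t).symm
  have key : ∀ᶠ ε in 𝓝[≥] (0 : ℝ), ∀ σ, ∀ᶠ t in atTop, 0 ≤ output A B (θ + ε • ψ) σ t := by
    refine eventually_all.2 fun σ => ?_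
    by_cases hσ : σ ∈ D.index B κ
    · filter_upwards [self_mem_nhdsWithin] with ε hε
      filter_upwards [eventually_ge_atTop 0] with t ht
      rw [output_add_smul, hθ, hψ, Finset.sum_eq_zero, zero_add]
      · exact mul_nonneg hε (hζ σ hσ t ht)
      · intro ν _
        by_cases h : ν < κ
        · exact hE2 ν σ t (D.index_subset_indexSeq_succ B h hσ)
        · exact hE0 ν σ t fun h' => h h'.2
    · obtain ⟨ν, hνκ, him, hσν, r, hr⟩ := D.exists_removed B hσ
      set α := (D.μ ν).re with hαdef
      have hνκ' : ν < κ := hνκ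
      set c := (D.LamB B ν r σ ⬝ᵥ v ν) / (r : ℕ).factorial with hc
      have hcpos : 0 < c := div_pos (hv' ν σ hσν r hr) (by exact_mod_cast Nat.factorial_pos _)
      -- All terms of the polynomial are nonnegative and the one of degree `r` is at least `c` once
      -- `t ≥ 1`.
      have hmain : ∀ t : ℝ, 1 ≤ t → c ≤ Real.exp (-α * t) * E ν σ t := by
        intro t ht
        rw [hE1 ν him hνκ', ← mul_assoc, ← Real.exp_add, ← hαdef, neg_mul, neg_add_cancel,
          Real.exp_zero, one_mul]
        have hterm : ∀ s ∈ Finset.range n,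
            0 ≤ t ^ s / (s.factorial : ℝ) * (D.LamB B ν s σ ⬝ᵥ v ν) := fun s _ =>
          mul_nonneg (by positivity) (D.LamB_dotProduct_nonneg B (hv ν) hσν s)
        refine le_trans ?_ (Finset.single_le_sum hterm
          (Finset.mem_range.2 (r.2.trans_le (D.mult_le ν))))
        rw [hc, div_mul_eq_mul_div]
        gcongr
        exact le_mul_of_one_le_left (hv ν σ hσν r) (one_le_pow₀ ht)
      -- Eigenvalues before `ν` are invisible because `σ ∈ I_ν`; later real ones have strictly
      -- smaller real part.
      have hrest : ∀ ν' ∈ Finset.univ.erase ν,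
          Tendsto (fun t : ℝ => Real.exp (-α * t) * E ν' σ t) atTop (𝓝 0) := by
        intro ν' hν'
        rcases lt_or_gt_of_ne (Finset.ne_of_mem_erase hν') with hlt | hlt
        · have : ∀ t, E ν' σ t = 0 := fun t =>
            hE2 ν' σ t (D.index_subset_indexSeq_succ B hlt hσν)
          simp [this]
        · by_cases h : (D.μ ν').im = 0 ∧ ν' < κ
          · refine D.tendsto_exp_mul_outputC B ν' (w ν') σ
              (lt_of_le_of_ne (D.μ_antitone ν ν' hlt.le) fun heq => hlt.ne ?_)
            exact D.μ_injective (Complex.ext heq.symm (him.trans h.1.symm))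
          · have : ∀ t, E ν' σ t = 0 := fun t => hE0 ν' σ t h
            simp [this]
      have hrest' := tendsto_finsetSum _ hrest
      rw [Finset.sum_const_zero] at hrest'
      -- If `Re μ_κ = α`, then `μ_κ` is non-real, being distinct from the real eigenvalue `μ_ν = α`;
      -- here the semisimplicity assumption applies.
      obtain ⟨C, hC0, hC⟩ := D.exists_eventually_abs_exp_mul_outputC_le B κ ζ σ (α := α) (by
        rcases (D.μ_antitone ν κ hνκ'.le).lt_or_eq with h | h
        · exact Or.inl h
        · refine Or.inr ⟨h, h₁ κ (fun him' => hνκ'.ne ?_) ⟨ν, ?_⟩⟩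
          · exact D.μ_injective (Complex.ext h.symm (him.trans him'.symm))
          · exact Complex.ext h (by simp [him]))
      -- This bound on `ε` makes the perturbation cost at most `c/2`; the other background terms
      -- cost at most another `c/2`, against a gain of `c`. Adding `1` to `C` avoids a zero
      -- denominator.
      have hε₀ : 0 < c / (2 * (C + 1)) := by positivity
      filter_upwards [Icc_mem_nhdsGE hε₀] with ε hε
      filter_upwards [hC, hrest'.eventually (lt_mem_nhds (a := -(c / 2)) (by linarith)),
        eventually_ge_atTop 1] with t htC htr ht1
      have hpos := Real.exp_pos (-α * t)
      refine nonneg_of_mul_nonneg_right (b := output A B (θ + ε • ψ) σ t) ?_ hpos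
      rw [output_add_smul, hθ, hψ, ← Finset.add_sum_erase _ _ (Finset.mem_univ ν), mul_add, mul_add,
        Finset.mul_sum, mul_left_comm]
      have h1 := hmain t ht1
      have h2 : -(c / 2) ≤ ε * (Real.exp (-α * t) *
          (outputC A B (fun i => D.U κ *ᵥ ζ i) σ t).re) := by
        have h3 := (abs_le.1 htC).1
        have h4 : ε * (C + 1) ≤ c / 2 := by
          have := mul_le_mul_of_nonneg_right hε.2 (show 0 ≤ C + 1 by linarith)
          refine this.trans (le_of_eq ?_)
          field_simp
        have h5 := mul_le_mul_of_nonneg_left h3 hε.1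
        have := hε.1
        linarith
      linarith
  have hagree : ∀ ε : ℝ, (∀ σ, ∀ᶠ t in atTop, 0 ≤ output A B (θ + ε • ψ) σ t) →
      (θ + ε • ψ) k = (θ + ε • ψ) l := by
    intro ε hε
    obtain ⟨T, hT⟩ := eventually_atTop.1 (eventually_all.2 hε)
    refine exp_smul_mulVec_injective Aᵀ T
      (hP (fun i => NormedSpace.exp (T • Aᵀ) *ᵥ (θ + ε • ψ) i) fun σ t ht => ?_)
    rw [output_exp]
    exact hT _ (by linarith) σ
  -- The background alone (`ε = 0`) and a small positive perturbation of it both agree on the pair;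
  -- their difference gives the claim for `ψ`.
  have h0 := hagree 0 (key.self_of_nhdsWithin Set.self_mem_Ici)
  obtain ⟨ε, hε, hε0⟩ := ((key.filter_mono (nhdsWithin_mono _ Set.Ioi_subset_Ici_self)).and
    self_mem_nhdsWithin).exists
  have h2 := hagree ε hε
  have h3 := congrFun h0 a
  have h4 := congrFun h2 a
  simp only [Pi.add_apply, Pi.smul_apply, smul_eq_mul, zero_mul, add_zero] at h3 h4
  rw [h3] at h4
  exact mul_left_cancel₀ (ne_of_gt hε0) (add_left_cancel h4)

/-- A Farkas certificate against connectivity is a vector of the dual cone that differs on the pair.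
All its output coefficients in `I_κ` are nonnegative, so it would have to agree on the pair. -/
theorem stronglyPairConnected_of_output (h₁ : D.SemisimpleAssumption) {k l : Fin q}
    (hP : ∀ η : Fin q → Fin n → ℝ, (∀ σ t, 0 ≤ t → 0 ≤ output A B η σ t) → η k = η l)
    (κ : Fin D.m) (hκ : (D.μ κ).im = 0) : StronglyPairConnected (D.incQ B κ) k l := by
  refine ⟨fun ia j => ?_, ?_⟩
  · change ((D.Lam κ ^ (j.2 : ℕ) *ᵥ D.Bk B κ ia.1 j.1) ia.2).im = 0
    rw [D.Lam_pow_mulVec_Bk B hκ, Complex.ofReal_im]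
  · rintro _ ⟨y, rfl⟩
    by_contra hcon
    obtain ⟨v, hv, hv'⟩ := exists_dotProduct_neg_of_notMem_cone _ hcon
    have hv1 : ∀ σ ∈ D.index B κ, ∀ r : Fin (D.mult κ), 0 ≤ D.LamB B κ r σ ⬝ᵥ v := by
      intro σ hσ r
      have := hv (⟨σ, hσ⟩, r)
      rwa [incQ, inc_Q_col] at this
    have h := D.re_U_mulVec_eq_of_outputC_nonneg B h₁ hP κ (fun i a => (v (i, a) : ℂ)) (by
      intro σ hσ t ht
      rw [D.re_outputC_of_im_eq_zero B hκ]
      exact mul_nonneg (Real.exp_pos _).le (Finset.sum_nonneg fun r _ =>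
        mul_nonneg (by positivity) (D.LamB_dotProduct_nonneg B hv1 hσ r)))
    have h2 : (fun a => (v (k, a) : ℂ)) = fun a => (v (l, a) : ℂ) := by
      refine D.U_mulVec_injective κ (funext fun a => Complex.ext (h a) ?_)
      rw [mulVec_im_eq_zero (D.U_real κ hκ) (fun _ => Complex.ofReal_im _),
        mulVec_im_eq_zero (D.U_real κ hκ) (fun _ => Complex.ofReal_im _)]
    have h3 : ∀ a, v (k, a) = v (l, a) := fun a => Complex.ofReal_injective (congrFun h2 a)
    rw [sum_pairMatrix_mulVec_mul] at hv'
    simp [h3] at hv'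

/-- Over the complex numbers, a vector outside the range of a matrix is detected by a vector
orthogonal to all columns. -/
lemma exists_conjTranspose_mulVec_eq_zero {ρ ι : Type*} [Fintype ρ] [Fintype ι]
    (G : Matrix ρ ι ℂ) {v : ρ → ℂ} (hv : v ∉ Set.range G.mulVec) :
    ∃ ζ : ρ → ℂ, Gᴴ *ᵥ ζ = 0 ∧ v ⬝ᵥ star ζ ≠ 0 := by
  classical
  obtain ⟨f, hf, hf'⟩ := Submodule.exists_le_ker_of_notMem (p := LinearMap.range G.mulVecLin)
    (v := v) (by simpa using hv)
  have key : ∀ x : ρ → ℂ, f x = x ⬝ᵥ fun j => f (Pi.single j 1) := by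
    intro x
    conv_lhs => rw [pi_eq_sum_univ' x]
    simp [dotProduct]
  refine ⟨star fun j => f (Pi.single j 1), ?_, by rwa [star_star, ← key]⟩
  rw [← Matrix.star_vecMul]
  ext j
  have h1 : f (G *ᵥ Pi.single j 1) = 0 := hf' ⟨Pi.single j 1, rfl⟩
  rw [key, Matrix.mulVec_single_one] at h1
  rw [Pi.star_apply, Pi.zero_apply, star_eq_zero, ← h1]
  simp [Matrix.vecMul, dotProduct, mul_comm]

theorem pairConnected_of_output (h₁ : D.SemisimpleAssumption) {k l : Fin q}
    (hP : ∀ η : Fin q → Fin n → ℝ, (∀ σ t, 0 ≤ t → 0 ≤ output A B η σ t) → η k = η l)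
    (κ : Fin D.m) : PairConnected (D.incQ B κ) k l := by
  rintro _ ⟨y, rfl⟩
  by_contra hcon
  obtain ⟨z, hz, hz'⟩ := exists_conjTranspose_mulVec_eq_zero _ hcon
  let ζ : Fin q → Fin (D.mult κ) → ℂ := fun i a => z (i, a)
  have hcoeff : ∀ σ ∈ D.index B κ, ∀ r : ℕ, D.coeff B κ ζ σ r = 0 := by
    intro σ hσ r
    rcases lt_or_ge r (D.mult κ) with hr | hr
    · rw [coeff_eq_sum_star]
      have := congrFun hz (⟨σ, hσ⟩, ⟨r, hr⟩)
      simp only [Matrix.mulVec, dotProduct, Fintype.sum_prod_type] at this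
      exact this
    · exact D.coeff_eq_zero B κ ζ σ hr
  -- All outputs of `ζ` in `I_κ` vanish, so every complex multiple qualifies as well; the multiples
  -- by `1` and `I` recover the real and imaginary parts.
  have hre : ∀ c : ℂ, ∀ a, ((D.U κ *ᵥ (c • ζ) k) a).re = ((D.U κ *ᵥ (c • ζ) l) a).re := by
    intro c
    refine D.re_U_mulVec_eq_of_outputC_nonneg B h₁ hP κ (c • ζ) fun σ hσ t _ => ?_
    rw [D.outputC_U, Finset.sum_eq_zero, Complex.zero_re]
    intro r _
    rw [coeff_smul, hcoeff σ hσ, mul_zero, zero_mul]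
  have h2 : ζ k = ζ l := by
    refine D.U_mulVec_injective κ (funext fun a => Complex.ext ?_ ?_)
    · simpa using hre 1 a
    · simpa [Matrix.mulVec_smul] using hre Complex.I a
  refine hz' ?_
  rw [sum_pairMatrix_mulVec_mul]
  refine Finset.sum_eq_zero fun a _ => ?_
  have : z (k, a) = z (l, a) := congrFun h2 a
  simp [this]

end SpectralData

end RelArray

namespace RelArray

open Filter Topology

/-! ### Variation of constants -/

section VariationOfConstants

variable {n : ℕ}

lemma intervalIntegrable_mulVec {m : ℕ} {M : ℝ → Matrix (Fin m) (Fin n) ℝ} (hM : Continuous M)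
    {b : ℝ → Fin n → ℝ} {s t : ℝ} (hb : IntervalIntegrable b volume s t) :
    IntervalIntegrable (fun r => M r *ᵥ b r) volume s t := by
  rw [intervalIntegrable_iff] at hb ⊢
  refine Integrable.of_eval fun a => ?_
  have h : ∀ j, IntervalIntegrable (fun r => M r a j * b r j) volume s t := fun j =>
    IntervalIntegrable.continuousOn_mul (intervalIntegrable_iff.2 (hb.eval j))
      (hM.matrix_elem a j).continuousOn
  simp only [Matrix.mulVec, dotProduct]
  exact integrable_finsetSum _ fun j _ => intervalIntegrable_iff.1 (h j)

lemma mulVec_intervalIntegral {m : ℕ} (M : Matrix (Fin m) (Fin n) ℝ) {b : ℝ → Fin n → ℝ} {s t : ℝ}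
    (hb : IntervalIntegrable b volume s t) :
    M *ᵥ (∫ r in s..t, b r) = ∫ r in s..t, M *ᵥ b r :=
  ((LinearMap.toContinuousLinearMap M.mulVecLin).intervalIntegral_comp_comm hb).symm

/-- Fubini's theorem on a triangle. -/
lemma integral_mulVec_primitive {K : ℝ → Matrix (Fin n) (Fin n) ℝ} (hK : Continuous K)
    {c : ℝ → Fin n → ℝ} {t : ℝ} (ht : 0 ≤ t) (hc : IntervalIntegrable c volume 0 t) :
    ∫ r in (0 : ℝ)..t, K r *ᵥ (∫ s in (0 : ℝ)..r, c s) =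
      ∫ s in (0 : ℝ)..t, ∫ r in s..t, K r *ᵥ c s := by
  let F : ℝ → ℝ → Fin n → ℝ := fun r s => (Set.Iic r).indicator (fun s => K r *ᵥ c s) s
  have hF : ∀ r s, F r s = (Set.Ici s).indicator (fun r => K r *ᵥ c s) r := fun r s => by
    simp only [F, Set.indicator_apply, Set.mem_Iic, Set.mem_Ici]
  have hci : IntegrableOn c (Set.Ioc 0 t) := (intervalIntegrable_iff_integrableOn_Ioc_of_le ht).1 hc
  have hint : IntegrableOn F.uncurry (Set.uIoc 0 t ×ˢ Set.uIoc 0 t) := by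
    rw [Set.uIoc_of_le ht]
    have h1 : IntegrableOn (fun x : ℝ × ℝ => K x.1 *ᵥ c x.2) (Set.Ioc 0 t ×ˢ Set.Ioc 0 t) := by
      rw [IntegrableOn, Measure.volume_eq_prod, ← Measure.prod_restrict]
      refine Integrable.of_eval fun a => ?_
      have h : ∀ j, Integrable (fun x : ℝ × ℝ => K x.1 a j * c x.2 j)
          ((volume.restrict (Set.Ioc 0 t)).prod (volume.restrict (Set.Ioc 0 t))) := fun j =>
        Integrable.mul_prod (f := fun r => K r a j) (g := fun s => c s j)
          ((hK.matrix_elem a j).integrableOn_Ioc) (hci.eval j)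
      simp only [Matrix.mulVec, dotProduct]
      exact integrable_finsetSum _ fun j _ => h j
    have h2 : F.uncurry = {x : ℝ × ℝ | x.2 ≤ x.1}.indicator fun x => K x.1 *ᵥ c x.2 := by
      ext1 ⟨r, s⟩
      simp only [F, Function.uncurry_apply_pair, Set.indicator_apply, Set.mem_Iic, Set.mem_ofPred_eq]
    rw [h2]
    exact h1.indicator (measurableSet_le measurable_snd measurable_fst)
  have hl : ∀ r ∈ Set.uIcc 0 t, K r *ᵥ (∫ s in (0 : ℝ)..r, c s) = ∫ s in (0 : ℝ)..t, F r s := by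
    intro r hr
    rw [Set.uIcc_of_le ht] at hr
    rw [mulVec_intervalIntegral (K r) (hc.mono_set (by
      rw [Set.uIcc_of_le hr.1, Set.uIcc_of_le ht]; exact Set.Icc_subset_Icc_right hr.2)),
      intervalIntegral.integral_of_le ht, setIntegral_indicator measurableSet_Iic,
      Set.Ioc_inter_Iic, min_eq_right hr.2, intervalIntegral.integral_of_le hr.1]
  have hr : ∀ s, s ∈ Set.Ioc 0 t → ∫ r in (0 : ℝ)..t, F r s = ∫ r in s..t, K r *ᵥ c s := by
    intro s hs
    have : Set.Ioc 0 t ∩ Set.Ici s = Set.Icc s t := by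
      ext r
      simp only [Set.mem_inter_iff, Set.mem_Ioc, Set.mem_Ici, Set.mem_Icc]
      exact ⟨fun h => ⟨h.2, h.1.2⟩, fun h => ⟨⟨hs.1.trans_le h.1, h.2⟩, h.1⟩⟩
    simp only [hF]
    rw [intervalIntegral.integral_of_le ht, setIntegral_indicator measurableSet_Ici, this,
      integral_Icc_eq_integral_Ioc, intervalIntegral.integral_of_le hs.2]
  rw [intervalIntegral.integral_congr hl, intervalIntegral_intervalIntegral_swap hint]
  refine intervalIntegral.integral_congr_ae (Eventually.of_forall fun s hs => ?_)
  rw [Set.uIoc_of_le ht] at hs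
  exact hr s hs

variable (A : Matrix (Fin n) (Fin n) ℝ)

section
open scoped Matrix.Norms.Operator

lemma hasDerivAt_exp_smul_mulVec (v : Fin n → ℝ) (t : ℝ) :
    HasDerivAt (fun r : ℝ => NormedSpace.exp (r • A) *ᵥ v) (A *ᵥ (NormedSpace.exp (t • A) *ᵥ v))
      t := by
  have h := hasDerivAt_exp_smul_const' (𝕂 := ℝ) A t
  let L : Matrix (Fin n) (Fin n) ℝ →ₗ[ℝ] (Fin n → ℝ) :=
    { toFun := fun X => X *ᵥ v
      map_add' := fun X Y => Matrix.add_mulVec X Y v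
      map_smul' := fun c X => Matrix.smul_mulVec c X v }
  rw [Matrix.mulVec_mulVec]
  exact (LinearMap.toContinuousLinearMap L).hasFDerivAt.comp_hasDerivAt t h

end

lemma integral_mulVec_exp (v : Fin n → ℝ) (s t : ℝ) :
    ∫ r in s..t, A *ᵥ (NormedSpace.exp (r • A) *ᵥ v) =
      NormedSpace.exp (t • A) *ᵥ v - NormedSpace.exp (s • A) *ᵥ v :=
  intervalIntegral.integral_eq_sub_of_hasDerivAt (fun r _ => hasDerivAt_exp_smul_mulVec A v r)
    (Continuous.intervalIntegrable (continuous_const.matrix_mulVec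
      ((continuous_exp_smul A).matrix_mulVec continuous_const)) _ _)

/-- The response `∫_0^t e^{A(t-s)} b(s) ds` to a forcing `b`. -/
def response (b : ℝ → Fin n → ℝ) (t : ℝ) : Fin n → ℝ :=
  ∫ s in (0 : ℝ)..t, NormedSpace.exp ((t - s) • A) *ᵥ b s

variable {A} {b : ℝ → Fin n → ℝ} {τ : ℝ}

lemma continuous_exp_sub_smul (A : Matrix (Fin n) (Fin n) ℝ) (t : ℝ) :
    Continuous fun s : ℝ => NormedSpace.exp ((t - s) • A) :=
  (continuous_exp_smul A).comp (continuous_const.sub continuous_id)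

lemma continuous_exp_neg_smul (A : Matrix (Fin n) (Fin n) ℝ) :
    Continuous fun s : ℝ => NormedSpace.exp ((-s) • A) :=
  (continuous_exp_smul A).comp continuous_neg

lemma response_eq {t : ℝ} (hb : IntervalIntegrable b volume 0 t) :
    response A b t = NormedSpace.exp (t • A) *ᵥ
      ∫ s in (0 : ℝ)..t, NormedSpace.exp ((-s) • A) *ᵥ b s := by
  rw [mulVec_intervalIntegral _ (intervalIntegrable_mulVec (continuous_exp_neg_smul A) hb)]
  simp only [Matrix.mulVec_mulVec, ← exp_add_smul]
  rfl

lemma intervalIntegrable_of_mem_Icc {E : Type*} [NormedAddCommGroup E] {f : ℝ → E}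
    (hb : IntervalIntegrable f volume 0 τ) {t : ℝ}
    (ht : t ∈ Set.Icc 0 τ) : IntervalIntegrable f volume 0 t := by
  refine hb.mono_set ?_
  rw [Set.uIcc_of_le ht.1, Set.uIcc_of_le (ht.1.trans ht.2)]
  exact Set.Icc_subset_Icc_right ht.2

lemma continuousOn_response (hτ : 0 ≤ τ) (hb : IntervalIntegrable b volume 0 τ) :
    ContinuousOn (response A b) (Set.Icc 0 τ) := by
  have h1 := intervalIntegral.continuousOn_primitive_interval'
    (intervalIntegrable_mulVec (continuous_exp_neg_smul A) hb) Set.left_mem_uIcc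
  rw [Set.uIcc_of_le hτ] at h1
  refine ContinuousOn.congr ?_ fun t ht => response_eq (intervalIntegrable_of_mem_Icc hb ht)
  rw [continuousOn_iff_continuous_domRestrict] at h1 ⊢
  exact ((continuous_exp_smul A).comp continuous_subtype_val).matrix_mulVec h1

/-- The forcing is merely integrable, so Fubini on the triangle replaces differentiation: the inner
integral of `A e^{(r-s)A} b(s)` over `r ∈ [s, t]` is `e^{(t-s)A} b(s) - b(s)`. -/
lemma response_eq_integral {t : ℝ} (ht : 0 ≤ t) (hb : IntervalIntegrable b volume 0 t) :
    response A b t = ∫ s in (0 : ℝ)..t, (A *ᵥ response A b s + b s) := by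
  have hc := intervalIntegrable_mulVec (continuous_exp_neg_smul A) hb
  have hcont : ContinuousOn (fun s => A *ᵥ response A b s) (Set.uIcc 0 t) := by
    rw [Set.uIcc_of_le ht]
    exact (LinearMap.continuous_of_finiteDimensional A.mulVecLin).comp_continuousOn
      (continuousOn_response ht hb)
  rw [intervalIntegral.integral_add hcont.intervalIntegrable hb]
  have h1 : ∫ s in (0 : ℝ)..t, A *ᵥ response A b s =
      ∫ r in (0 : ℝ)..t, (A * NormedSpace.exp (r • A)) *ᵥ
        ∫ s in (0 : ℝ)..r, NormedSpace.exp ((-s) • A) *ᵥ b s := by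
    refine intervalIntegral.integral_congr fun r hr => ?_
    rw [Set.uIcc_of_le ht] at hr
    rw [response_eq (intervalIntegrable_of_mem_Icc hb hr), Matrix.mulVec_mulVec]
  have h2 : ∀ s, ∫ r in s..t, (A * NormedSpace.exp (r • A)) *ᵥ (NormedSpace.exp ((-s) • A) *ᵥ b s) =
      NormedSpace.exp ((t - s) • A) *ᵥ b s - b s := by
    intro s
    simp only [← Matrix.mulVec_mulVec]
    rw [integral_mulVec_exp, Matrix.mulVec_mulVec, Matrix.mulVec_mulVec, ← exp_add_smul,
      ← exp_add_smul, add_neg_cancel, ← sub_eq_add_neg]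
    simp
  rw [h1, integral_mulVec_primitive (continuous_const.matrix_mul (continuous_exp_smul A)) ht hc]
  simp only [h2]
  rw [intervalIntegral.integral_sub
    (intervalIntegrable_mulVec (continuous_exp_sub_smul A t) hb) hb, sub_add_cancel]
  rfl

/-- Extended continuously beyond the interval, `y` makes the right-hand side a `C¹` function, and
uniqueness for the Lipschitz equation `y' = A y` applies. -/
lemma eqOn_zero_of_eq_integral (hτ : 0 ≤ τ) {y : ℝ → Fin n → ℝ}
    (hy : ContinuousOn y (Set.Icc 0 τ))
    (h : ∀ t ∈ Set.Icc 0 τ, y t = ∫ s in (0 : ℝ)..t, A *ᵥ y s) : ∀ t ∈ Set.Icc 0 τ, y t = 0 := by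
  let y' : ℝ → Fin n → ℝ := Set.IccExtend hτ (fun t : Set.Icc 0 τ => y t)
  have hy' : Continuous y' := (continuousOn_iff_continuous_domRestrict.1 hy).Icc_extend'
  have heq : ∀ t ∈ Set.Icc 0 τ, y' t = y t := fun t ht => Set.IccExtend_of_mem _ _ ht
  let g : ℝ → Fin n → ℝ := fun t => ∫ s in (0 : ℝ)..t, A *ᵥ y' s
  have hAy : Continuous fun s => A *ᵥ y' s := continuous_const.matrix_mulVec hy'
  have hg : ∀ t, HasDerivAt g (A *ᵥ y' t) t := fun t =>
    intervalIntegral.integral_hasDerivAt_right (hAy.intervalIntegrable _ _)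
      (hAy.stronglyMeasurableAtFilter _ _) hAy.continuousAt
  have hgy : ∀ t ∈ Set.Icc 0 τ, g t = y t := by
    intro t ht
    rw [h t ht]
    refine intervalIntegral.integral_congr fun s hs => ?_
    rw [Set.uIcc_of_le ht.1] at hs
    rw [heq s ⟨hs.1, hs.2.trans ht.2⟩]
  have hLip : ∀ t ∈ Set.Ico 0 τ, LipschitzOnWith ‖LinearMap.toContinuousLinearMap A.mulVecLin‖₊
      (fun x => A *ᵥ x) (Set.univ : Set (Fin n → ℝ)) := fun t _ =>
    (LinearMap.toContinuousLinearMap A.mulVecLin).lipschitz.lipschitzOnWith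
  have := ODE_solution_unique_of_mem_Icc_right (v := fun _ x => A *ᵥ x) (s := fun _ => Set.univ)
    (f := g) (g := fun _ => 0) (a := 0) (b := τ) hLip
    (fun t _ => (hg t).continuousAt.continuousWithinAt)
    (fun t ht => by
      have h1 := (hg t).hasDerivWithinAt (s := Set.Ici t)
      rwa [heq t ⟨ht.1, ht.2.le⟩, ← hgy t ⟨ht.1, ht.2.le⟩] at h1)
    (fun _ _ => Set.mem_univ _) continuousOn_const
    (fun t _ => by
      simpa using hasDerivWithinAt_const t (Set.Ici t) (0 : Fin n → ℝ))
    (fun _ _ => Set.mem_univ _) (by simp [g])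
  intro t ht
  rw [← hgy t ht]
  exact this ht

end VariationOfConstants

end RelArray

namespace RelArray

open Filter Topology

variable {q p n : ℕ} (A : Matrix (Fin n) (Fin n) ℝ) (B : Fin q → Fin p → Fin n → ℝ)

/-! ### Trajectories of the array -/

/-- The forcing `∑_σ B_{iσ} u_σ` of the `i`th system. -/
def forcing (u : ℝ → Fin p → ℝ) (i : Fin q) (t : ℝ) : Fin n → ℝ := ∑ σ, u t σ • B i σ

variable {τ : ℝ} {u : ℝ → Fin p → ℝ}

lemma intervalIntegrable_forcing {s t : ℝ}
    (hu : ∀ σ, IntervalIntegrable (fun t => u t σ) volume s t) (i : Fin q) :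
    IntervalIntegrable (forcing B u i) volume s t := by
  simp only [intervalIntegrable_iff] at hu ⊢
  exact integrable_finsetSum _ fun σ _ => (hu σ).smul_const (B i σ)

variable {A B}

lemma isTrajectory_response (hτ : 0 ≤ τ)
    (hu : ∀ σ, IntervalIntegrable (fun t => u t σ) volume 0 τ) (x₀ : Fin q → Fin n → ℝ) :
    IsTrajectory A B τ u fun t i =>
      NormedSpace.exp (t • A) *ᵥ x₀ i + response A (forcing B u i) t := by
  have hexp : ∀ v : Fin n → ℝ, Continuous fun t : ℝ => NormedSpace.exp (t • A) *ᵥ v := fun v =>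
    (continuous_exp_smul A).matrix_mulVec continuous_const
  have hz : ∀ i, ContinuousOn (response A (forcing B u i)) (Set.Icc 0 τ) := fun i =>
    continuousOn_response hτ (intervalIntegrable_forcing B hu i)
  refine ⟨continuousOn_pi.2 fun i => (hexp _).continuousOn.add (hz i), fun t ht i => ?_⟩
  have hb := intervalIntegrable_of_mem_Icc (intervalIntegrable_forcing B hu i) ht
  have hzt : ContinuousOn (response A (forcing B u i)) (Set.uIcc 0 t) := by
    rw [Set.uIcc_of_le ht.1]
    exact (hz i).mono (Set.Icc_subset_Icc_right ht.2)
  have hAz : IntervalIntegrable (fun s => A *ᵥ response A (forcing B u i) s) volume 0 t :=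
    ((LinearMap.continuous_of_finiteDimensional A.mulVecLin).comp_continuousOn
      hzt).intervalIntegrable
  have hAe : IntervalIntegrable (fun s => A *ᵥ (NormedSpace.exp (s • A) *ᵥ x₀ i)) volume 0 t :=
    (continuous_const.matrix_mulVec (hexp (x₀ i))).intervalIntegrable _ _
  have h0 : response A (forcing B u i) 0 = 0 := by simp [response]
  have h1 : ∫ s in (0 : ℝ)..t, (A *ᵥ (NormedSpace.exp (s • A) *ᵥ x₀ i +
      response A (forcing B u i) s) + ∑ σ, u s σ • B i σ) =
      (∫ s in (0 : ℝ)..t, A *ᵥ (NormedSpace.exp (s • A) *ᵥ x₀ i)) +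
        ∫ s in (0 : ℝ)..t, (A *ᵥ response A (forcing B u i) s + forcing B u i s) := by
    rw [← intervalIntegral.integral_add hAe (hAz.add hb)]
    refine intervalIntegral.integral_congr fun s _ => ?_
    simp only [Matrix.mulVec_add, add_assoc, forcing]
  simp only [h0, zero_smul, NormedSpace.exp_zero, Matrix.one_mulVec, add_zero]
  rw [h1, integral_mulVec_exp, ← response_eq_integral ht.1 hb]
  simp only [zero_smul, NormedSpace.exp_zero, Matrix.one_mulVec]
  abel

/-- The difference from the explicit solution satisfies the homogeneous integral equation, hence
vanishes. -/
lemma IsTrajectory.eq_response (hτ : 0 ≤ τ)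
    (hu : ∀ σ, IntervalIntegrable (fun t => u t σ) volume 0 τ)
    {x : ℝ → Fin q → Fin n → ℝ} (hx : IsTrajectory A B τ u x) (i : Fin q) :
    x τ i = NormedSpace.exp (τ • A) *ᵥ x 0 i + response A (forcing B u i) τ := by
  set x' : ℝ → Fin q → Fin n → ℝ := fun t i =>
    NormedSpace.exp (t • A) *ᵥ x 0 i + response A (forcing B u i) t with hx'def
  have hx' : IsTrajectory A B τ u x' := isTrajectory_response hτ hu (x 0)
  have hc : ContinuousOn (fun t => x t i) (Set.Icc 0 τ) := continuousOn_pi.1 hx.1 i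
  have hc' : ContinuousOn (fun t => x' t i) (Set.Icc 0 τ) := continuousOn_pi.1 hx'.1 i
  have h0 : x' 0 i = x 0 i := by simp [x', response]
  have hA : ∀ {y : ℝ → Fin n → ℝ}, ContinuousOn y (Set.Icc 0 τ) → ∀ t ∈ Set.Icc 0 τ,
      IntervalIntegrable (fun s => A *ᵥ y s) volume 0 t := fun hy t ht => by
    refine ContinuousOn.intervalIntegrable ?_
    rw [Set.uIcc_of_le ht.1]
    exact (LinearMap.continuous_of_finiteDimensional A.mulVecLin).comp_continuousOn
      (hy.mono (Set.Icc_subset_Icc_right ht.2))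
  have := eqOn_zero_of_eq_integral (A := A) hτ (y := fun t => x t i - x' t i) (hc.sub hc')
    (fun t ht => by
      have hb : IntervalIntegrable (fun s => ∑ σ, u s σ • B i σ) volume 0 t :=
        intervalIntegrable_of_mem_Icc (intervalIntegrable_forcing B hu i) ht
      rw [hx.2 t ht i, hx'.2 t ht i, h0, add_sub_add_left_eq_sub,
        ← intervalIntegral.integral_sub ((hA hc t ht).add hb) ((hA hc' t ht).add hb)]
      refine intervalIntegral.integral_congr fun s _ => ?_
      simp only [Matrix.mulVec_sub, add_sub_add_right_eq_sub]) τ (Set.right_mem_Icc.2 hτ)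
  exact sub_eq_zero.1 this

lemma sum_response_forcing (hB : IsRelative B)
    (hu : ∀ σ, IntervalIntegrable (fun t => u t σ) volume 0 τ) :
    ∑ i, response A (forcing B u i) τ = 0 := by
  simp only [response]
  rw [← intervalIntegral.integral_finsetSum fun i _ => intervalIntegrable_mulVec
    (continuous_exp_sub_smul A τ) (intervalIntegrable_forcing B hu i)]
  have h : ∀ t, ∑ i, NormedSpace.exp ((τ - t) • A) *ᵥ forcing B u i t = 0 := by
    intro t
    simp only [← Matrix.mulVec_sum, forcing]
    rw [Finset.sum_comm]
    simp only [← Finset.smul_sum, hB _, smul_zero, Finset.sum_const_zero, Matrix.mulVec_zero]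
  simp [h]

/-! ### Reachable cones -/

variable (A B)

/-- The cone of states that are positively reachable from the origin at time `τ`. -/
def reachableAt (τ : ℝ) : PointedCone ℝ (Fin q → Fin n → ℝ) where
  carrier := {ξ | ∃ u, IsPositiveInput τ u ∧ ∀ i, ξ i = response A (forcing B u i) τ}
  add_mem' := by
    rintro ξ ξ' ⟨u, hu, hξ⟩ ⟨u', hu', hξ'⟩
    refine ⟨fun t σ => u t σ + u' t σ, ⟨fun σ => (hu.1 σ).add (hu'.1 σ), fun t ht σ =>
      add_nonneg (hu.2 t ht σ) (hu'.2 t ht σ)⟩, fun i => ?_⟩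
    rw [Pi.add_apply, hξ, hξ', response, response, ← intervalIntegral.integral_add
      (intervalIntegrable_mulVec (continuous_exp_sub_smul A τ)
        (intervalIntegrable_forcing B hu.1 i))
      (intervalIntegrable_mulVec (continuous_exp_sub_smul A τ)
        (intervalIntegrable_forcing B hu'.1 i))]
    simp only [response, forcing, add_smul, Finset.sum_add_distrib, Matrix.mulVec_add]
  zero_mem' := ⟨0, ⟨fun _ => intervalIntegrable_const, fun _ _ _ => le_rfl⟩, fun i => by
    simp [response, forcing]⟩
  smul_mem' := by
    rintro c ξ ⟨u, hu, hξ⟩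
    refine ⟨fun t σ => c * u t σ, ⟨fun σ => (hu.1 σ).const_mul c, fun t ht σ =>
      mul_nonneg c.2 (hu.2 t ht σ)⟩, fun i => ?_⟩
    change (c : ℝ) • ξ i = _
    rw [hξ]
    simp only [response, forcing, mul_smul, ← Finset.smul_sum, Matrix.mulVec_smul,
      intervalIntegral.integral_smul]

variable {A B}

/-- Rest at the origin for time `t - s`, then apply the old input. -/
lemma reachableAt_mono {s t : ℝ} (hs : 0 ≤ s) (hst : s ≤ t) :
    reachableAt A B s ≤ reachableAt A B t := by
  rintro ξ ⟨u, hu, hξ⟩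
  set d := t - s with hd
  have hd0 : 0 ≤ d := sub_nonneg.2 hst
  let u' : ℝ → Fin p → ℝ := fun r σ => if r ≤ d then 0 else u (r - d) σ
  have hu'1 : ∀ r ∈ Set.uIoc 0 d, ∀ σ, u' r σ = 0 := fun r hr σ => by
    rw [Set.uIoc_of_le hd0] at hr
    exact if_pos hr.2
  have hu'2 : ∀ r ∈ Set.uIoc d t, ∀ σ, u' r σ = u (r - d) σ := fun r hr σ => by
    rw [Set.uIoc_of_le (by linarith)] at hr
    exact if_neg (not_le.2 hr.1)
  have hi1 : ∀ σ, IntervalIntegrable (fun r => u' r σ) volume 0 d := fun σ =>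
    (intervalIntegrable_congr fun r hr => hu'1 r hr σ).2 intervalIntegrable_const
  have hi2 : ∀ σ, IntervalIntegrable (fun r => u' r σ) volume d t := fun σ => by
    refine (intervalIntegrable_congr fun r hr => hu'2 r hr σ).2 ?_
    have := (hu.1 σ).comp_sub_right d
    rwa [zero_add, hd, add_sub_cancel] at this
  refine ⟨u', ⟨fun σ => (hi1 σ).trans (hi2 σ), fun r hr σ => ?_⟩, fun i => ?_⟩
  · by_cases h : r ≤ d
    · simp [u', h]
    · simp only [u', h, if_false]
      exact hu.2 _ ⟨by linarith, by linarith [hr.2]⟩ σ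
  · have hc := continuous_exp_sub_smul A t
    rw [hξ, response, response, ← intervalIntegral.integral_add_adjacent_intervals
      (intervalIntegrable_mulVec hc (intervalIntegrable_forcing B hi1 i))
      (intervalIntegrable_mulVec hc (intervalIntegrable_forcing B hi2 i))]
    rw [intervalIntegral.integral_congr_ae (a := 0) (b := d) (g := fun _ => 0)
      (Eventually.of_forall fun r hr => by simp [forcing, hu'1 r hr]),
      intervalIntegral.integral_congr_ae (a := d) (b := t)
      (g := fun r => NormedSpace.exp ((s - (r - d)) • A) *ᵥ forcing B u i (r - d))
      (Eventually.of_forall fun r hr => by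
        simp only [forcing, hu'2 r hr]
        rw [show s - (r - d) = t - r by rw [hd]; ring]),
      intervalIntegral.integral_comp_sub_right
        (fun r => NormedSpace.exp ((s - r) • A) *ᵥ forcing B u i r) d]
    simp [hd]

/-- Apply the old input first, then drift freely for time `t - s`. -/
lemma exp_mulVec_mem_reachableAt {s t : ℝ} (hs : 0 ≤ s) (hst : s ≤ t) {ξ : Fin q → Fin n → ℝ}
    (hξ : ξ ∈ reachableAt A B s) :
    (fun i => NormedSpace.exp ((t - s) • A) *ᵥ ξ i) ∈ reachableAt A B t := by
  obtain ⟨u, hu, hξ⟩ := hξ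
  let u' : ℝ → Fin p → ℝ := fun r σ => if r ≤ s then u r σ else 0
  have hu'1 : ∀ r ∈ Set.uIoc 0 s, ∀ σ, u' r σ = u r σ := fun r hr σ => by
    rw [Set.uIoc_of_le hs] at hr
    exact if_pos hr.2
  have hu'2 : ∀ r ∈ Set.uIoc s t, ∀ σ, u' r σ = 0 := fun r hr σ => by
    rw [Set.uIoc_of_le hst] at hr
    exact if_neg (not_le.2 hr.1)
  have hi1 : ∀ σ, IntervalIntegrable (fun r => u' r σ) volume 0 s := fun σ =>
    (intervalIntegrable_congr fun r hr => hu'1 r hr σ).2 (hu.1 σ)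
  have hi2 : ∀ σ, IntervalIntegrable (fun r => u' r σ) volume s t := fun σ =>
    (intervalIntegrable_congr fun r hr => hu'2 r hr σ).2 intervalIntegrable_const
  refine ⟨u', ⟨fun σ => (hi1 σ).trans (hi2 σ), fun r hr σ => ?_⟩, fun i => ?_⟩
  · by_cases h : r ≤ s
    · simp only [u', h, if_true]
      exact hu.2 r ⟨hr.1, h⟩ σ
    · simp [u', h]
  · have hc := continuous_exp_sub_smul A t
    change NormedSpace.exp ((t - s) • A) *ᵥ ξ i = _
    rw [hξ, response, response, ← intervalIntegral.integral_add_adjacent_intervals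
      (intervalIntegrable_mulVec hc (intervalIntegrable_forcing B hi1 i))
      (intervalIntegrable_mulVec hc (intervalIntegrable_forcing B hi2 i)),
      mulVec_intervalIntegral _ (intervalIntegrable_mulVec (continuous_exp_sub_smul A s)
        (intervalIntegrable_forcing B hu.1 i)),
      intervalIntegral.integral_congr_ae (a := s) (b := t) (g := fun _ => 0)
      (Eventually.of_forall fun r hr => by simp [forcing, hu'2 r hr]),
      intervalIntegral.integral_zero, add_zero]
    refine intervalIntegral.integral_congr_ae (Eventually.of_forall fun r hr => ?_)
    simp only [forcing, hu'1 r hr]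
    rw [Matrix.mulVec_mulVec, ← exp_add_smul, sub_add_sub_cancel]

/-- The vector `(e_k - e_ℓ) ⊗ w`, as a function of `w`. -/
def pairVector (k l : Fin q) : (Fin n → ℝ) →ₗ[ℝ] (Fin q → Fin n → ℝ) where
  toFun w i := (Pi.single k (1 : ℝ) - Pi.single l (1 : ℝ) : Fin q → ℝ) i • w
  map_add' v w := by ext; simp [mul_add]
  map_smul' c w := by ext; simp; ring

lemma pairVector_apply (k l : Fin q) (w : Fin n → ℝ) (i : Fin q) :
    pairVector k l w i = (Pi.single k (1 : ℝ) - Pi.single l (1 : ℝ) : Fin q → ℝ) i • w := rfl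

/-- Blockwise multiplication by a matrix. -/
def blockMulVec (M : Matrix (Fin n) (Fin n) ℝ) : (Fin q → Fin n → ℝ) →ₗ[ℝ] (Fin q → Fin n → ℝ) where
  toFun ξ i := M *ᵥ ξ i
  map_add' ξ ξ' := by ext1 i; exact Matrix.mulVec_add _ _ _
  map_smul' c ξ := by ext1 i; exact Matrix.mulVec_smul M c (ξ i)

lemma blockMulVec_pairVector (M : Matrix (Fin n) (Fin n) ℝ) (k l : Fin q) (w : Fin n → ℝ) :
    blockMulVec M (pairVector k l w) = pairVector k l (M *ᵥ w) := by
  ext1 i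
  exact Matrix.mulVec_smul M ((Pi.single k (1 : ℝ) - Pi.single l (1 : ℝ) : Fin q → ℝ) i) w

/-- Responses vanish off the pair and sum to zero, so they are opposite at `k` and `l`; meeting then
forces each to cover half of the propagated gap. -/
lemma positivelyPairControllable_iff_exp (hB : IsRelative B) {k l : Fin q} (hkl : k ≠ l) :
    PositivelyPairControllable A B k l ↔
      ∀ w, ∃ τ, 0 < τ ∧ pairVector k l (NormedSpace.exp (τ • A) *ᵥ w) ∈ reachableAt A B τ := by
  constructor
  · intro h w
    -- With a gap of `-2w`, the response at `k` must be exactly `e^{τA} w`.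
    obtain ⟨τ, hτ, u, hu, x, hx, hx0, hkl', hi⟩ := h (Pi.single k ((-2 : ℝ) • w))
    refine ⟨τ, hτ, u, hu, ?_⟩
    have hsum := sum_response_forcing (A := A) hB hu.1
    have hxr := hx.eq_response hτ.le hu.1
    have hz : ∀ i, i ≠ k → i ≠ l → response A (forcing B u i) τ = 0 := by
      intro i hik hil
      have := hxr i
      rw [hi i hik hil, hx0] at this
      exact (left_eq_add.1 this)
    have hs : response A (forcing B u k) τ + response A (forcing B u l) τ = 0 := by
      rw [← hsum, Fintype.sum_eq_add k l hkl fun i hi => hz i hi.1 hi.2]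
    have h2 : response A (forcing B u k) τ = NormedSpace.exp (τ • A) *ᵥ w := by
      rw [hxr, hxr, hx0, eq_neg_of_add_eq_zero_right hs] at hkl'
      simp only [Pi.single_eq_same, Pi.single_eq_of_ne hkl.symm, Matrix.mulVec_smul,
        Matrix.mulVec_zero, zero_add] at hkl'
      have h3 : (2 : ℝ) • response A (forcing B u k) τ =
          (2 : ℝ) • (NormedSpace.exp (τ • A) *ᵥ w) := by
        rw [neg_smul, neg_add_eq_iff_eq_add] at hkl'
        rw [two_smul]
        nth_rewrite 1 [hkl']
        abel
      exact smul_right_injective _ two_ne_zero h3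
    intro i
    rw [pairVector_apply]
    by_cases hik : i = k
    · subst hik
      simp [h2, hkl]
    · by_cases hil : i = l
      · subst hil
        rw [eq_neg_of_add_eq_zero_right hs, h2]
        simp [hik]
      · simp [hz i hik hil, hik, hil]
  · intro h x₀
    obtain ⟨τ, hτ, u, hu, hξ⟩ := h ((2⁻¹ : ℝ) • (x₀ l - x₀ k))
    refine ⟨τ, hτ, u, hu, _, isTrajectory_response hτ.le hu.1 x₀, ?_, ?_, ?_⟩
    · ext1 i
      simp [response]
    · simp only [← hξ, pairVector_apply]
      simp only [Pi.sub_apply, Pi.single_eq_same, Pi.single_eq_of_ne hkl,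
        Pi.single_eq_of_ne hkl.symm, sub_zero, zero_sub, one_smul, neg_smul, Matrix.mulVec_smul,
        Matrix.mulVec_sub]
      ext a
      simp only [Pi.add_apply, Pi.smul_apply, Pi.sub_apply, Pi.neg_apply, smul_eq_mul]
      ring
    · intro i hik hil
      simp only [← hξ, pairVector_apply]
      simp [hik, hil]

lemma bigA_smul (t : ℝ) : t • bigA q A = bigA q (t • A) := (Matrix.kronecker_smul t 1 A).symm

lemma bigA_mulVec (M : Matrix (Fin n) (Fin n) ℝ) (ξ : Fin q × Fin n → ℝ) (i : Fin q)
    (a : Fin n) : (bigA q M *ᵥ ξ) (i, a) = (M *ᵥ fun b => ξ (i, b)) a := by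
  simp [bigA, Matrix.mulVec, dotProduct, Fintype.sum_prod_type, Matrix.one_apply]

end RelArray

namespace RelArray

open Filter Topology

variable {q p n : ℕ} {A : Matrix (Fin n) (Fin n) ℝ} {B : Fin q → Fin p → Fin n → ℝ}

/-! ### From the stacked system to reachability of the pair subspace -/

lemma bigB_mulVec (w : Fin p → ℝ) (i : Fin q) (a : Fin n) :
    (bigB B *ᵥ w) (i, a) = (∑ σ, w σ • B i σ) a := by
  simp [bigB, Matrix.mulVec, dotProduct, mul_comm]

lemma mem_reachable {ξ : Fin q × Fin n → ℝ} :
    ξ ∈ reachable A B ↔ ∃ τ, 0 ≤ τ ∧ (fun i a => ξ (i, a)) ∈ reachableAt A B τ := by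
  have key : ∀ (τ : ℝ) (u : ℝ → Fin p → ℝ), IsPositiveInput τ u → ∀ i a,
      (∫ t in (0 : ℝ)..τ, NormedSpace.exp ((τ - t) • bigA q A) *ᵥ (bigB B *ᵥ u t)) (i, a) =
        response A (forcing B u i) τ a := by
    intro τ u hu i a
    have h1 : ∀ t, ∀ ia : Fin q × Fin n,
        (NormedSpace.exp ((τ - t) • bigA q A) *ᵥ (bigB B *ᵥ u t)) ia =
          (NormedSpace.exp ((τ - t) • A) *ᵥ forcing B u ia.1 t) ia.2 := by
      rintro t ⟨i, a⟩
      rw [bigA_smul, exp_bigA, bigA_mulVec]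
      simp only [bigB_mulVec]
      rfl
    have hi := fun i => intervalIntegrable_iff.1 (intervalIntegrable_mulVec
      (continuous_exp_sub_smul A τ) (intervalIntegrable_forcing B hu.1 i))
    rw [response, intervalIntegral.intervalIntegral_eq_integral_uIoc,
      intervalIntegral.intervalIntegral_eq_integral_uIoc, Pi.smul_apply, Pi.smul_apply,
      eval_integral fun a => (hi i).eval a, eval_integral]
    · simp only [h1]
    · intro ia
      simp only [h1]
      exact (hi ia.1).eval ia.2
  constructor
  · rintro ⟨τ, hτ, u, hu, rfl⟩
    exact ⟨τ, hτ, u, hu, fun i => funext fun a => key τ u hu i a⟩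
  · rintro ⟨τ, hτ, u, hu, h⟩
    exact ⟨τ, hτ, u, hu, funext fun ia => (congrFun (h ia.1) ia.2).trans (key τ u hu _ _).symm⟩

lemma pairMatrix_mulVec_eq_pairVector (k l : Fin q) (w : Fin n → ℝ) :
    (fun i a => (pairMatrix ℝ k l n *ᵥ w) (i, a)) = pairVector k l w := by
  ext i a
  rw [pairMatrix_mulVec, pairVector_apply, Pi.smul_apply, smul_eq_mul]

/-- Positive pair controllability amounts to reachability of the pair subspace. -/
theorem positivelyPairControllable_iff (hB : IsRelative B) {k l : Fin q} (hkl : k ≠ l) :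
    PositivelyPairControllable A B k l ↔
      Set.range (pairMatrix ℝ k l n).mulVec ⊆ reachable A B := by
  rw [positivelyPairControllable_iff_exp hB hkl]
  constructor
  · intro h
    -- Pulled back by `e^{τA}`, the reachable cones still increase, by free drift. A common horizon
    -- then lets `w` be replaced by `e^{-τA} w`.
    obtain ⟨τ, hτ, hmem⟩ := exists_forall_mem_of_monotone_cones
      (fun τ => (reachableAt A B τ).comap (blockMulVec (NormedSpace.exp (τ • A))))
      (fun s t hs hst ξ hξ => by
        have := exp_mulVec_mem_reachableAt hs hst hξ
        change blockMulVec _ ξ ∈ reachableAt A B t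
        convert! this using 1
        ext1 i
        change NormedSpace.exp (t • A) *ᵥ ξ i =
          NormedSpace.exp ((t - s) • A) *ᵥ (NormedSpace.exp (s • A) *ᵥ ξ i)
        rw [Matrix.mulVec_mulVec, ← exp_add_smul, sub_add_cancel])
      (pairVector k l) (fun w => by
        obtain ⟨τ, hτ, hw⟩ := h w
        refine ⟨τ, hτ.le, ?_⟩
        rwa [PointedCone.mem_comap, blockMulVec_pairVector])
    rintro _ ⟨w, rfl⟩
    rw [mem_reachable, pairMatrix_mulVec_eq_pairVector]
    refine ⟨τ, hτ.le, ?_⟩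
    have := hmem (NormedSpace.exp ((-τ) • A) *ᵥ w)
    rwa [PointedCone.mem_comap, blockMulVec_pairVector, Matrix.mulVec_mulVec, ← exp_add_smul,
      add_neg_cancel, zero_smul, NormedSpace.exp_zero, Matrix.one_mulVec] at this
  · intro h
    -- The target `e^{τA} w` moves with `τ`, so a horizon valid for all vectors at once is needed.
    obtain ⟨τ, hτ, hmem⟩ := exists_forall_mem_of_monotone_cones (reachableAt A B)
      (fun s t hs hst => reachableAt_mono hs hst) (pairVector k l) (fun w => by
        have := h ⟨w, rfl⟩
        rwa [mem_reachable, pairMatrix_mulVec_eq_pairVector] at this)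
    exact fun w => ⟨τ, hτ, hmem _⟩

variable (A B)

/-- The set of positively reachable states, as a cone. -/
def reachableCone : PointedCone ℝ (Fin q × Fin n → ℝ) where
  carrier := reachable A B
  add_mem' := by
    intro ξ ξ' h h'
    obtain ⟨s, hs, h⟩ := mem_reachable.1 h
    obtain ⟨t, ht, h'⟩ := mem_reachable.1 h'
    exact mem_reachable.2 ⟨max s t, le_max_of_le_left hs, Submodule.add_mem _
      (reachableAt_mono hs (le_max_left s t) h) (reachableAt_mono ht (le_max_right s t) h')⟩
  zero_mem' := mem_reachable.2 ⟨0, le_rfl, Submodule.zero_mem _⟩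
  smul_mem' := by
    intro c ξ h
    obtain ⟨s, hs, h⟩ := mem_reachable.1 h
    exact mem_reachable.2 ⟨s, hs, Submodule.smul_mem _ c h⟩

variable {A B}

/-! ### Duality between reachable states and nonnegative outputs -/

/-- Pairing of a reachable state with a state of the adjoint system. -/
lemma sum_response_dotProduct {τ : ℝ} {u : ℝ → Fin p → ℝ}
    (hu : ∀ σ, IntervalIntegrable (fun t => u t σ) volume 0 τ) (η : Fin q → Fin n → ℝ) :
    ∑ i, response A (forcing B u i) τ ⬝ᵥ η i =
      ∫ t in (0 : ℝ)..τ, ∑ σ, u t σ * output A B η σ (τ - t) := by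
  have hi := fun i => intervalIntegrable_mulVec (continuous_exp_sub_smul A τ)
    (intervalIntegrable_forcing B hu i)
  have h1 : ∀ i, response A (forcing B u i) τ ⬝ᵥ η i = ∫ t in (0 : ℝ)..τ,
      (NormedSpace.exp ((τ - t) • A) *ᵥ forcing B u i t) ⬝ᵥ η i := by
    intro i
    let L : (Fin n → ℝ) →ₗ[ℝ] ℝ :=
      { toFun := fun w => w ⬝ᵥ η i
        map_add' := fun x y => add_dotProduct x y _
        map_smul' := fun c x => smul_dotProduct c x _ }
    exact ((LinearMap.toContinuousLinearMap L).intervalIntegral_comp_comm (hi i)).symm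
  have h2 : ∀ i, IntervalIntegrable
      (fun t => (NormedSpace.exp ((τ - t) • A) *ᵥ forcing B u i t) ⬝ᵥ η i) volume 0 τ := by
    intro i
    have := fun a => (((intervalIntegrable_iff.1 (hi i)).eval a).mul_const (η i a))
    rw [intervalIntegrable_iff]
    simp only [dotProduct]
    exact integrable_finsetSum _ fun a _ => this a
  simp only [h1]
  rw [← intervalIntegral.integral_finsetSum fun i _ => h2 i]
  refine intervalIntegral.integral_congr fun t _ => ?_
  simp only [forcing, output, Matrix.mulVec_sum, Matrix.mulVec_smul, sum_dotProduct,
    smul_dotProduct, smul_eq_mul, Finset.mul_sum]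
  rw [Finset.sum_comm]
  refine Finset.sum_congr rfl fun σ _ => Finset.sum_congr rfl fun i _ => ?_
  rw [← Matrix.transpose_smul, Matrix.exp_transpose, Matrix.dotProduct_mulVec,
    Matrix.vecMul_transpose]

/-- Test with the input that is the negative part of the time-reversed output in channel `σ`: the
pairing is minus the integral of its square. -/
lemma output_nonneg_of_forall_reachable {η : Fin q → Fin n → ℝ}
    (h : ∀ τ, 0 ≤ τ → ∀ ξ ∈ reachableAt A B τ, 0 ≤ ∑ i, ξ i ⬝ᵥ η i) (σ : Fin p) (t : ℝ)
    (ht : 0 ≤ t) : 0 ≤ output A B η σ t := by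
  classical
  by_contra! hneg
  -- The horizon `t + 1` keeps the interval nondegenerate for `t = 0`; output time `t` corresponds
  -- to `s = 1`.
  let g : ℝ → ℝ := fun s => output A B η σ (t + 1 - s)
  have hg : Continuous g := (continuous_output B η σ).comp (by fun_prop)
  let u : ℝ → Fin p → ℝ := fun s => Pi.single σ (max 0 (-g s))
  have hu : IsPositiveInput (t + 1) u := by
    refine ⟨fun σ' => ?_, fun s _ σ' => ?_⟩
    · by_cases h : σ' = σ
      · subst h
        simp only [u, Pi.single_eq_same]
        exact (continuous_const.max hg.neg).intervalIntegrable _ _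
      · simp [u, h]
    · by_cases h : σ' = σ
      · subst h
        simp [u]
      · simp [u, h]
  have h1 := h (t + 1) (by linarith) (fun i => response A (forcing B u i) (t + 1))
    ⟨u, hu, fun _ => rfl⟩
  rw [sum_response_dotProduct hu.1] at h1
  have h2 : ∀ s, ∑ σ', u s σ' * output A B η σ' (t + 1 - s) = -(max 0 (-g s) * max 0 (-g s)) := by
    intro s
    rw [Finset.sum_eq_single σ (fun σ' _ h => by simp [u, h]) (by simp)]
    simp only [u, Pi.single_eq_same]
    change max 0 (-g s) * g s = _
    rcases le_total 0 (-g s) with h0 | h0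
    · rw [max_eq_right h0]; ring
    · rw [max_eq_left h0]; ring
  simp only [h2, intervalIntegral.integral_neg] at h1
  have h3 : 0 < ∫ s in (0 : ℝ)..(t + 1), max 0 (-g s) * max 0 (-g s) := by
    refine intervalIntegral.integral_pos (by linarith)
      ((continuous_const.max hg.neg).mul (continuous_const.max hg.neg)).continuousOn
      (fun s _ => mul_self_nonneg _) ⟨1, ⟨zero_le_one, by linarith⟩, ?_⟩
    have : 0 < max 0 (-g 1) := by
      refine lt_max_of_lt_right ?_
      simp only [g, add_sub_cancel_right]
      linarith
    positivity
  linarith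

/-- The pair subspace lies in the closure of the reachable cone if and only if every initial state
of the adjoint system with nonnegative outputs agrees on the pair. -/
theorem range_subset_closure_reachable_iff {k l : Fin q} :
    Set.range (pairMatrix ℝ k l n).mulVec ⊆ closure (reachable A B) ↔
      ∀ η : Fin q → Fin n → ℝ, (∀ σ t, 0 ≤ t → 0 ≤ output A B η σ t) → η k = η l := by
  constructor
  · intro h η hη
    have h1 : ∀ x ∈ closure (reachable A B), 0 ≤ x ⬝ᵥ fun ia => η ia.1 ia.2 := by
      refine closure_minimal (fun x hx => ?_)
        (isClosed_le continuous_const (continuous_id.dotProduct continuous_const))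
      obtain ⟨τ, hτ, u, hu, hξ⟩ := mem_reachable.1 hx
      change 0 ≤ x ⬝ᵥ fun ia => η ia.1 ia.2
      rw [dotProduct_prod, Finset.sum_congr rfl fun i _ => by rw [show
        (fun a => x (i, a)) = response A (forcing B u i) τ from hξ i], sum_response_dotProduct hu.1]
      exact intervalIntegral.integral_nonneg hτ fun t ht => Finset.sum_nonneg fun σ _ =>
        mul_nonneg (hu.2 t ht σ) (hη σ _ (sub_nonneg.2 ht.2))
    ext a
    have h2 := h1 _ (h ⟨Pi.single a 1, rfl⟩)
    have h3 := h1 _ (h ⟨Pi.single a (-1), rfl⟩)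
    rw [sum_pairMatrix_mulVec_mul] at h2 h3
    simp [Pi.single_apply] at h2 h3
    exact le_antisymm h3 h2
  · rintro h _ ⟨w, rfl⟩
    by_contra hcon
    obtain ⟨η, hη, hη'⟩ := exists_dotProduct_neg_of_notMem_closure (reachableCone A B) hcon
    have h1 := h (fun i a => η (i, a)) (output_nonneg_of_forall_reachable fun τ hτ ξ hξ => by
      have := hη (fun ia => ξ ia.1 ia.2) (mem_reachable.2 ⟨τ, hτ, hξ⟩)
      rwa [dotProduct_prod] at this)
    rw [sum_pairMatrix_mulVec_mul] at hη'
    have h2 : ∀ a, η (k, a) = η (l, a) := fun a => congrFun h1 a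
    simp [h2] at hη'

end RelArray

end

theorem theorem5 {q p n : ℕ} (A : Matrix (Fin n) (Fin n) ℝ) (B : Fin q → Fin p → Fin n → ℝ)
    (hB : RelArray.IsRelative B) (k l : Fin q) (hkl : k ≠ l) (D : RelArray.SpectralData A)
    (h₁ : D.SemisimpleAssumption) (h₂ : RelArray.ClosureAssumption A B k l) :
    RelArray.PositivelyPairControllable A B k l ↔
      ((∀ κ, (D.μ κ).im = 0 → RelArray.StronglyPairConnected (D.incQ B κ) k l) ∧
        (∀ κ, (D.μ κ).im ≠ 0 → RelArray.PairConnected (D.incQ B κ) k l)) := by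
  rw [RelArray.positivelyPairControllable_iff hB hkl]
  constructor
  · intro h
    have hP := RelArray.range_subset_closure_reachable_iff.1 (h.trans subset_closure)
    exact ⟨fun κ hκ => D.stronglyPairConnected_of_output B h₁ hP κ hκ,
      fun κ _ => D.pairConnected_of_output B h₁ hP κ⟩
  · rintro ⟨ha, hb⟩
    exact h₂ (RelArray.range_subset_closure_reachable_iff.2 fun η hη =>
      D.eq_of_output_nonneg B ha hb hη)
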